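/- \textbf{System.} Let $p,q\ge 1$ and $\theta=[a_1,\dots,a_p,b_1,\dots,b_q]^T\in\mathbb R^{p+q}$ with $a_p\ne 0$, put $A(z)=a_1+a_2z+\cdots+a_pz^{p-1}$, $B(z)=b_1+b_2z+\cdots+b_qz^{q-1}$, and suppose that $1-zA(z)$ and $B(z)$ have no common complex root. Let $(u_k)_{k\in\mathbb Z}$ be a deterministic real input and let $(y_k)$, with arbitrary deterministic initial values $y_k$ for $k\le 0$, satisfy for all $k\ge 1$ $$y_k=\sum_{j=1}^p a_jy_{k-j}+\sum_{j=1}^q b_ju_{k-j+1}=\phi_k^T\theta,\qquad \phi_k=[y_{k-1},\dots,y_{k-p},u_k,\dots,u_{k-q+1}]^T .$$ Only $s_k=1$ if $y_k+d_k\le C$ and $s_k=0$ if $y_k+d_k>C$ $(k\ge1)$ are observed, where $C\in\mathbb R$ is a fixed threshold. \textbf{Assumptions.} (1) $0<h<1$, and $\theta\in\Theta$, where $\Theta\subset\mathbb R^{p+q}$ is convex and compact and, for every $[a_1',\dots,a_p',b_1',\dots,b_q']^T\in\Theta$, all complex roots of $1-a_1'z-\cdots-a_p'z^p$ have modulus greater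 than $1/h$. Put $R_\Theta=\sup_{v\in\Theta}\|v\|$. (2) $d_1,d_2,\dots$ are i.i.d. with mean zero and known distribution function $F$, which has a continuous density $f=F'$ with $f(x)\neq0$ for all $x$. (3) $(u_k)_{k\ge1}$ is bounded, and there are $\delta_1>0$ and an integer $m>0$ such that $\frac1m\sum_{i=k}^{k+m-1}U_iU_i^T\ge\delta_1I_{p+q}$ for all $k\ge1$, where $U_i=[u_i,u_{i-1},\dots,u_{i-p-q+1}]^T$. \textbf{Algorithm.} Let $\Pi_\Theta$ be the Euclidean projection onto $\Theta$ and $\gamma>0$ a step size. From deterministic initial values $\hat\theta_0$ and $\hat y_k$ $(k\le0)$, define for $k\ge1$ $$\varphi_k=[\hat y_{k-1},\dots,\hat y_{k-p},u_k,\dots,u_{k-q+1}]^T,\quad \hat\theta_k=\Pi_\Theta\Bigl\{\hat\theta_{k-1}+\frac{\gamma}{k}\varphi_k\bigl(F(C-\varphi_k^T\hat\theta_{k-1})-s_k\bigr)\Bigr\},\quad \hat y_k=\varphi_k^T\hat\theta_k .$$ \textbf{Constants.} Let $g(h)=\sum_{j=1}^p\binom pj^2h^{2j}$ and let $A$ be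 the $p\times p$ companion matrix with first row $(a_1,\dots,a_p)$, ones on the subdiagonal and zeros elsewhere; write $\rho(A)$ for its spectral radius and $\|A\|$ for its Euclidean operator norm. Then there are $\varepsilon>0$ with $\rho(A)+\varepsilon\|A\|<1$, $M_1>0$ with $\|\phi_k\|\le M_1$ for all $k\ge1$, and $\delta>0$ with $$\frac1N\sum_{i=k}^{k+N-1}\phi_i\phi_i^T\ge\delta I_{p+q}\quad\text{for all }k\ge1,\qquad N=p+m .$$ \textbf{Theorem (Convergence).} Let $\varepsilon>0$ and $h_1$ satisfy $\rho(A)+\varepsilon\|A\|\le h_1<1$, put $M=\sqrt p\,(1+2/\varepsilon)^{p-1}$, let $M_1$ and $\delta$ be any constants with the above properties, and let $M_2>0$ be any constant such that $\|\varphi_k\|\le M_2$ almost surely for all $k\ge1$. Let $f_M$ and $f_m$ be the maximum and the minimum of $f$ on $[C-R_\Theta M_2,C+R_\Theta M_2]\cup[C-R_\Theta M_1,C+R_\Theta M_1]$. If $$f_m\delta-\frac{f_M\sqrt{g(h)}\,M_2M}{1-h_1}(M_2+2M_1)>0,$$ then $E\|\hat\theta_k-\theta\|^2<\infty$ for every $k$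 and $$\lim_{k\to\infty}E\|\hat\theta_k-\theta\|^2=0 .$$ -/

import Mathlib

open MeasureTheory ProbabilityTheory Filter Topology

namespace BinaryARMA

noncomputable section

/-- Parameter vectors `[a₁, …, a_p, b₁, …, b_q]` with the Euclidean norm; the coordinate
`Sum.inl j` is `a_{j+1}` and the coordinate `Sum.inr j` is `b_{j+1}`. -/
abbrev Param (p q : ℕ) : Type := EuclideanSpace ℝ (Fin p ⊕ Fin q)

variable {p q : ℕ}

/-- The polynomial `1 - z A(z) = 1 - a₁ z - ⋯ - a_p z^p`, over `ℂ`. -/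
def arPoly (v : Param p q) : Polynomial ℂ :=
  1 - ∑ j : Fin p, Polynomial.C ((v (Sum.inl j) : ℝ) : ℂ) * Polynomial.X ^ ((j : ℕ) + 1)

/-- The polynomial `B(z) = b₁ + b₂ z + ⋯ + b_q z^(q-1)`, over `ℂ`. -/
def maPoly (v : Param p q) : Polynomial ℂ :=
  ∑ j : Fin q, Polynomial.C ((v (Sum.inr j) : ℝ) : ℂ) * Polynomial.X ^ (j : ℕ)

/-- The parameters for which all complex roots of `1 - z A(z)` have modulus greater than `1/h`.
For `0 < h < 1` such a model is in particular causal. -/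
def causalSet (p q : ℕ) (h : ℝ) : Set (Param p q) :=
  {v | ∀ z : ℂ, (arPoly v).eval z = 0 → 1 / h < ‖z‖}

/-- `g(h) = p² h² + (p(p-1)/2)² h⁴ + ⋯ + h^(2p)`. -/
def gBound (p : ℕ) (h : ℝ) : ℝ :=
  ∑ j ∈ Finset.Icc 1 p, ((p.choose j : ℝ) * h ^ j) ^ 2

/-- The companion matrix: first row `a₁ … a_p`, ones on the subdiagonal, zeros elsewhere. -/
def companion (v : Param p q) : Matrix (Fin p) (Fin p) ℝ :=
  Matrix.of fun i j =>
    if (i : ℕ) = 0 then v (Sum.inl j) else if (j : ℕ) + 1 = (i : ℕ) then 1 else 0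

/-- The spectral radius of a real matrix: the largest modulus of its complex eigenvalues. -/
def specRad (A : Matrix (Fin p) (Fin p) ℝ) : ℝ :=
  (spectralRadius ℂ (A.map (fun x : ℝ => (x : ℂ)))).toReal

/-- The operator norm of a matrix for the Euclidean norm. -/
def opNorm (A : Matrix (Fin p) (Fin p) ℝ) : ℝ :=
  ‖Matrix.toEuclideanCLM (n := Fin p) (𝕜 := ℝ) A‖

/-- The constant `√p (1 + 2/ε)^(p-1)`. -/
def powerConst (p : ℕ) (ε : ℝ) : ℝ :=
  Real.sqrt p * (1 + 2 / ε) ^ (p - 1)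

/-- `[y_{k-1}, …, y_{k-p}, u_k, …, u_{k-q+1}]`. -/
def regressor (p q : ℕ) (y u : ℤ → ℝ) (k : ℤ) : Param p q :=
  WithLp.toLp 2 (Sum.elim (fun j : Fin p => y (k - 1 - (j : ℕ))) (fun j : Fin q => u (k - (j : ℕ))))

/-- `U_k = [u_k, u_{k-1}, …, u_{k-n+1}]`. -/
def inputWindow (n : ℕ) (u : ℤ → ℝ) (k : ℤ) : EuclideanSpace ℝ (Fin n) :=
  WithLp.toLp 2 (fun j : Fin n => u (k - (j : ℕ)))

/-- `(1/N) ∑_{i=k}^{k+N-1} w_i w_iᵀ ≥ δ I` for every time `k ≥ 1`, where the inequality between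
symmetric matrices is spelled out as the inequality between their quadratic forms. -/
def Excites {ι : Type*} [Fintype ι] (w : ℤ → EuclideanSpace ℝ ι) (N : ℕ) (δ : ℝ) : Prop :=
  ∀ k : ℤ, 1 ≤ k → ∀ x : EuclideanSpace ℝ ι,
    δ * ‖x‖ ^ 2 ≤ (1 / (N : ℝ)) * ∑ i ∈ Finset.range N, (inner ℝ (w (k + (i : ℤ))) x) ^ 2

/-- `y` is an output of the system `y_k = A(z) y_{k-1} + B(z) u_k`, `k ≥ 1`, with parameter `θ`
and input `u`; the values of `y` at times `k ≤ 0` are its initial values. -/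
def IsOutput (θ : Param p q) (u y : ℤ → ℝ) : Prop :=
  ∀ k : ℤ, 1 ≤ k →
    y k = (∑ j : Fin p, θ (Sum.inl j) * y (k - 1 - (j : ℕ))) +
      ∑ j : Fin q, θ (Sum.inr j) * u (k - (j : ℕ))

/-- The noise `d₁, d₂, …` is i.i.d. with mean zero and distribution function `F`, and `F` has the
continuous, nowhere vanishing density `f = F'`. -/
structure IsNoise {Ω : Type*} [MeasurableSpace Ω] (μ : Measure Ω) (d : ℕ → Ω → ℝ)
    (F f : ℝ → ℝ) : Prop where
  measurable : ∀ k, 1 ≤ k → Measurable (d k)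
  indep : iIndepFun (fun k : ℕ => d (k + 1)) μ
  cdf_eq : ∀ k, 1 ≤ k → ∀ x : ℝ, F x = μ.real {ω | d k ω ≤ x}
  integrable : ∀ k, 1 ≤ k → Integrable (d k) μ
  mean_zero : ∀ k, 1 ≤ k → ∫ ω, d k ω ∂μ = 0
  hasDerivAt : ∀ x, HasDerivAt F (f x) x
  continuous_density : Continuous f
  density_ne_zero : ∀ x, f x ≠ 0

/-- The binary observation `s = 1` if `z ≤ C`, and `s = 0` if `z > C`. -/
def binaryObs (C z : ℝ) : ℝ := if z ≤ C then 1 else 0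

/-- `v` is the point `Π_Θ(x)` of `Θ` that is closest to `x`. -/
def IsProj (Θ : Set (Param p q)) (x v : Param p q) : Prop :=
  v ∈ Θ ∧ ∀ w ∈ Θ, ‖x - v‖ ≤ ‖x - w‖

/-- One trajectory of the recursive projection algorithm with step size `γ`, threshold `C`, input
`u` and binary data `s₁, s₂, …`: with `φ_k = [ŷ_{k-1}, …, ŷ_{k-p}, u_k, …, u_{k-q+1}]`, for `k ≥ 1`,
`θ̂_k = Π_Θ(θ̂_{k-1} + (γ/k) φ_k (F(C - φ_kᵀ θ̂_{k-1}) - s_k))` and `ŷ_k = φ_kᵀ θ̂_k`.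
The vector `θ̂₀` and the numbers `ŷ_k`, `k ≤ 0`, are the initial values. -/
structure IsTrajectory (Θ : Set (Param p q)) (γ C : ℝ) (F : ℝ → ℝ) (u : ℤ → ℝ) (s : ℕ → ℝ)
    (θhat : ℕ → Param p q) (yhat : ℤ → ℝ) : Prop where
  estimate : ∀ k : ℕ, 1 ≤ k →
    IsProj Θ
      (θhat (k - 1) +
        ((γ / (k : ℝ)) * (F (C - inner ℝ (regressor p q yhat u k) (θhat (k - 1))) - s k)) •
          regressor p q yhat u k)
      (θhat k)
  predict : ∀ k : ℕ, 1 ≤ k → yhat k = inner ℝ (regressor p q yhat u k) (θhat k)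

/-- The radius `sup_{v ∈ Θ} ‖v‖`. -/
def radius (Θ : Set (Param p q)) : ℝ := sSup ((fun v => ‖v‖) '' Θ)

/-- `[C - B M₂, C + B M₂] ∪ [C - B M₁, C + B M₁]`. -/
def densityRange (C B M₁ M₂ : ℝ) : Set ℝ :=
  Set.Icc (C - B * M₂) (C + B * M₂) ∪ Set.Icc (C - B * M₁) (C + B * M₁)

end

end BinaryARMA

open BinaryARMA

/-! At time k+1 let ψ and φ be the regressors built from ŷ and from y, and put η = ŷ - y, z =
ψᵀ(θ̂_k - θ), β = (ψ - φ)ᵀθ. The Lyapunov function is V_k = E‖θ̂_k - θ‖². Projection onto a convex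
set containing θ does not increase the distance to θ, and given the past s_{k+1} has mean F(C -
y_{k+1}). Hence V grows by at most (2γ/(k+1)) E[z (F(C - ψᵀθ̂_k) - F(C - y_{k+1}))] + O(1/k²), and
by the mean value theorem the expression inside E is at most -f_m z² + f_M |z||β|.

The inputs cancel in β = ∑ a_j η_{k+1-j}, a filter of ℓ² gain at most s = √p ‖a‖, while η_{k+1} = z
+ β + O(1/k). This loop is closed by a small gain argument: if f_M s/(1 - s) < f_m, the drift is at
most -c(z² + η²), up to an increment of a storage function and O(1/k) (`exists_small_gain`,
`storage_succ_sub`, `IsTrajectory.lyapunov_step`). The numerical hypothesis of the theorem implies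
this condition (`arGain_small`).

Summation by parts against the steps 1/k absorbs the storage increments, so V_k converges and ∑ E(z²
+ η²)/k is finite. Excitation of φ bounds V_k by the values of z² and η² over a window of fixed
length (`IsTrajectory.window_bound`), so ∑ V_k/k is finite too. Since the harmonic series diverges,
the limit is 0 (`tendsto_zero_of_lyapunov`).

For the existence claims, the output is bounded because all characteristic roots lie inside the unit
disc, and φ inherits excitation from the input because 1 - zA and B are coprime
(`crossPoly_eq_zero`). -/

namespace BinaryARMA

/-! ### Characteristic roots, coefficient bounds and the companion matrix. -/

section Polynomials

open Polynomial

variable {p q : ℕ}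

/-- The reciprocal `X^p - a₁ X^(p-1) - ⋯ - a_p` of `1 - z A(z)`. -/
noncomputable def reciprocalPoly (v : Param p q) : ℂ[X] :=
  X ^ p - ∑ j : Fin p, C ((v (Sum.inl j) : ℝ) : ℂ) * X ^ (p - 1 - (j : ℕ))

lemma degree_reciprocalPoly_tail_lt (v : Param p q) :
    (∑ j : Fin p, C ((v (Sum.inl j) : ℝ) : ℂ) * X ^ (p - 1 - (j : ℕ))).degree <
      ((p : ℕ) : WithBot ℕ) := by
  refine (degree_sum_le _ _).trans_lt ?_
  rw [Finset.sup_lt_iff (by exact WithBot.bot_lt_coe p)]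
  intro j _
  refine (degree_C_mul_X_pow_le _ _).trans_lt ?_
  have := j.2
  exact_mod_cast (by omega : p - 1 - (j : ℕ) < p)

lemma reciprocalPoly_monic (v : Param p q) : (reciprocalPoly v).Monic :=
  monic_X_pow_sub (degree_reciprocalPoly_tail_lt v)

lemma natDegree_reciprocalPoly (v : Param p q) : (reciprocalPoly v).natDegree = p := by
  refine natDegree_eq_of_degree_eq_some ?_
  rw [reciprocalPoly, degree_sub_eq_left_of_degree_lt]
  · simp
  · simpa using degree_reciprocalPoly_tail_lt v

lemma coeff_reciprocalPoly (v : Param p q) (j : Fin p) :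
    (reciprocalPoly v).coeff (p - 1 - (j : ℕ)) = -((v (Sum.inl j) : ℝ) : ℂ) := by
  have hj := j.2
  rw [reciprocalPoly, coeff_sub, coeff_X_pow, if_neg (by omega), finsetSum_coeff, zero_sub,
    Finset.sum_eq_single j]
  · simp
  · intro b _ hb
    rw [coeff_C_mul_X_pow, if_neg]
    have := b.2
    intro h
    exact hb (Fin.ext (by omega))
  · simp

lemma norm_root_reciprocalPoly_lt {v : Param p q} {h : ℝ} (hh : 0 < h) (hv : v ∈ causalSet p q h)
    {z : ℂ} (hz : (reciprocalPoly v).eval z = 0) : ‖z‖ < h := by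
  rcases eq_or_ne z 0 with rfl | h0
  · simpa using hh
  have key : (arPoly v).eval z⁻¹ = 0 := by
    have : (reciprocalPoly v).eval z = z ^ p * (arPoly v).eval z⁻¹ := by
      simp only [reciprocalPoly, arPoly, eval_sub, eval_pow, eval_X, eval_finsetSum, eval_mul,
        eval_C, eval_one, mul_sub, mul_one, Finset.mul_sum]
      congr 1
      refine Finset.sum_congr rfl fun j _ => ?_
      have hj := j.2
      have e : z ^ p = z ^ (p - 1 - (j : ℕ)) * z ^ ((j : ℕ) + 1) := by
        rw [← pow_add]; congr 1; omega
      rw [e, inv_pow]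
      field_simp
    rw [hz] at this
    rcases mul_eq_zero.1 this.symm with h1 | h1
    · exact absurd h1 (pow_ne_zero _ h0)
    · exact h1
  have := hv _ key
  rw [norm_inv, one_div] at this
  exact (inv_lt_inv₀ hh (norm_pos_iff.2 h0)).1 this

/-- Vieta: up to sign the coefficient is an elementary symmetric function of p roots of modulus less
than h. This is the source of g(h). -/
lemma abs_coeff_le {v : Param p q} {h : ℝ} (hh : 0 < h) (hv : v ∈ causalSet p q h) (j : Fin p) :
    |v (Sum.inl j)| ≤ (p.choose ((j : ℕ) + 1) : ℝ) * h ^ ((j : ℕ) + 1) := by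
  have hj := j.2
  have := coeff_le_of_roots_le (f := RingHom.id ℂ) (B := h) (p - 1 - (j : ℕ))
    (reciprocalPoly_monic v) (IsAlgClosed.splits _) (fun z hz => by
      rw [Polynomial.map_id] at hz
      exact (norm_root_reciprocalPoly_lt hh hv (mem_roots'.1 hz).2).le)
  rw [Polynomial.map_id, coeff_reciprocalPoly, natDegree_reciprocalPoly, norm_neg,
    Complex.norm_real, Real.norm_eq_abs] at this
  have e : p - (p - 1 - (j : ℕ)) = j + 1 := by omega
  rw [e, ← Nat.choose_symm (by omega : p - 1 - (j : ℕ) ≤ p), e] at this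
  linarith

lemma sum_sq_coeff_le_gBound {v : Param p q} {h : ℝ} (hh : 0 < h) (hv : v ∈ causalSet p q h) :
    ∑ j : Fin p, v (Sum.inl j) ^ 2 ≤ gBound p h := by
  have e : Finset.Icc 1 p = Finset.Ico 1 (p + 1) := by ext; simp
  rw [gBound, e, Finset.sum_Ico_eq_sum_range, Nat.add_sub_cancel, Finset.sum_range]
  refine Finset.sum_le_sum fun j _ => ?_
  rw [add_comm 1 (j : ℕ)]
  exact sq_le_sq' (abs_le.1 (abs_coeff_le hh hv j)).1 (abs_le.1 (abs_coeff_le hh hv j)).2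

/-- The subdiagonal rows force an eigenvector to be a multiple of (z^(p-1), …, z, 1); the first row
is then the characteristic equation. -/
lemma eval_reciprocalPoly_eq_zero_of_mem_spectrum {v : Param p q} {z : ℂ}
    (hz : z ∈ spectrum ℂ ((companion v).map (fun x : ℝ => (x : ℂ)))) :
    (reciprocalPoly v).eval z = 0 := by
  rw [spectrum.mem_iff, Matrix.isUnit_iff_isUnit_det, isUnit_iff_ne_zero, not_not] at hz
  obtain ⟨w, hw0, hw⟩ := Matrix.exists_mulVec_eq_zero_iff.2 hz
  have hrow : ∀ i : Fin p, z * w i = ∑ j, ((companion v i j : ℝ) : ℂ) * w j := by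
    intro i
    have := congrFun hw i
    rw [Matrix.sub_mulVec] at this
    simp only [Matrix.algebraMap_eq_diagonal, Matrix.mulVec_diagonal, Pi.sub_apply, Pi.zero_apply,
      Pi.algebraMap_apply] at this
    simpa [Matrix.mulVec, dotProduct, sub_eq_zero] using this
  rcases Nat.eq_zero_or_pos p with rfl | hp
  · exact absurd (Subsingleton.elim w 0) hw0
  have hsub : ∀ (i : ℕ) (hi : i + 1 < p), w ⟨i, by omega⟩ = z * w ⟨i + 1, hi⟩ := by
    intro i hi
    rw [hrow, Finset.sum_eq_single ⟨i, by omega⟩]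
    · simp [companion]
    · intro b _ hb
      have : (b : ℕ) ≠ i := fun e => hb (Fin.ext e)
      simp [companion, this]
    · simp
  have hpow : ∀ n : ℕ, ∀ hn : n < p, w ⟨p - 1 - n, by omega⟩ = z ^ n * w ⟨p - 1, by omega⟩ := by
    intro n
    induction n with
    | zero => intro _; simp
    | succ n ih =>
      intro hn
      have e := hsub (p - 1 - (n + 1)) (by omega)
      have e2 : (⟨p - 1 - (n + 1) + 1, by omega⟩ : Fin p) = ⟨p - 1 - n, by omega⟩ :=
        Fin.ext (by simp only; omega)
      rw [e, e2, ih (by omega)]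
      ring
  have hpow' : ∀ j : Fin p, w j = z ^ (p - 1 - (j : ℕ)) * w ⟨p - 1, by omega⟩ := by
    intro j
    have hj := j.2
    rw [← hpow (p - 1 - j) (by omega)]
    congr 1
    exact Fin.ext (by simp only; omega)
  have hlast : w ⟨p - 1, by omega⟩ ≠ 0 := by
    intro h0
    refine hw0 (funext fun j => ?_)
    rw [hpow' j, h0, mul_zero]; rfl
  have h0 := hrow ⟨0, hp⟩
  rw [hpow' ⟨0, hp⟩] at h0
  have hz' : (reciprocalPoly v).eval z * w ⟨p - 1, by omega⟩ = 0 := by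
    simp only [reciprocalPoly, eval_sub, eval_pow, eval_X, eval_finsetSum, eval_mul, eval_C]
    have e : z ^ p = z * z ^ (p - 1) := by rw [← pow_succ']; congr 1; omega
    rw [sub_mul, e, Finset.sum_mul, mul_assoc]
    simp only [Nat.sub_zero] at h0
    rw [h0, sub_eq_zero]
    refine Finset.sum_congr rfl fun j _ => ?_
    rw [hpow' j]
    simp [companion, mul_assoc]
  exact (mul_eq_zero.1 hz').resolve_right hlast

lemma specRad_nonneg (A : Matrix (Fin p) (Fin p) ℝ) : 0 ≤ specRad A := ENNReal.toReal_nonneg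

lemma specRad_companion_le {v : Param p q} {h : ℝ} (hh : 0 < h) (hv : v ∈ causalSet p q h) :
    specRad (companion v) ≤ h := by
  refine ENNReal.toReal_le_of_le_ofReal hh.le ?_
  refine iSup₂_le fun z hz => ?_
  have := norm_root_reciprocalPoly_lt hh hv (eval_reciprocalPoly_eq_zero_of_mem_spectrum hz)
  rw [← enorm_eq_nnnorm, ← ofReal_norm]
  exact ENNReal.ofReal_le_ofReal this.le

lemma exists_pos_specRad_add_lt {v : Param p q} {h : ℝ} (hh : 0 < h) (hh1 : h < 1)
    (hv : v ∈ causalSet p q h) :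
    ∃ ε : ℝ, 0 < ε ∧ specRad (companion v) + ε * opNorm (companion v) < 1 := by
  have h1 := specRad_companion_le hh hv
  have h2 : 0 ≤ opNorm (companion v) := norm_nonneg _
  refine ⟨(1 - h) / (opNorm (companion v) + 1), by apply div_pos <;> linarith, ?_⟩
  have : (1 - h) / (opNorm (companion v) + 1) * opNorm (companion v) < 1 - h := by
    rw [div_mul_eq_mul_div, div_lt_iff₀ (by linarith)]
    nlinarith
  linarith

/-- For `p = 1` the spectral radius of the companion matrix is `|a₁|`. -/
lemma abs_le_specRad_companion_one {v : Param 1 q} {h : ℝ} (hh : 0 < h)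
    (hv : v ∈ causalSet 1 q h) : |v (Sum.inl 0)| ≤ specRad (companion v) := by
  have hmem : ((v (Sum.inl 0) : ℝ) : ℂ) ∈
      spectrum ℂ ((companion v).map (fun x : ℝ => (x : ℂ))) := by
    rw [spectrum.mem_iff, Matrix.isUnit_iff_isUnit_det, isUnit_iff_ne_zero, not_not]
    simp [companion, Matrix.algebraMap_eq_diagonal]
  have hle : (‖((v (Sum.inl 0) : ℝ) : ℂ)‖₊ : ENNReal) ≤
      spectralRadius ℂ ((companion v).map (fun x : ℝ => (x : ℂ))) :=
    le_iSup₂ (f := fun k (_ : k ∈ spectrum ℂ ((companion v).map (fun x : ℝ => (x : ℂ)))) =>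
      (‖k‖₊ : ENNReal)) _ hmem
  -- `toReal` sends `⊤` to 0, so monotonicity needs a finite spectral radius.
  have hfin : spectralRadius ℂ ((companion v).map (fun x : ℝ => (x : ℂ))) ≠ ⊤ := by
    refine ne_top_of_le_ne_top (ENNReal.ofReal_ne_top (r := h)) ?_
    refine iSup₂_le fun z hz => ?_
    have := norm_root_reciprocalPoly_lt hh hv (eval_reciprocalPoly_eq_zero_of_mem_spectrum hz)
    rw [← enorm_eq_nnnorm, ← ofReal_norm]
    exact ENNReal.ofReal_le_ofReal this.le
  have := ENNReal.toReal_mono hfin hle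
  simpa [specRad] using this

/-- The image of the first basis vector has second coordinate 1. For p ≥ 2 this yields ε ≤ ε‖A‖ ≤
h₁. -/
lemma one_le_opNorm_companion (v : Param p q) (hp : 2 ≤ p) : 1 ≤ opNorm (companion v) := by
  have h := (Matrix.toEuclideanCLM (n := Fin p) (𝕜 := ℝ) (companion v)).le_opNorm
    (EuclideanSpace.single ⟨0, by omega⟩ 1)
  rw [PiLp.norm_single, norm_one, mul_one] at h
  refine le_trans ?_ h
  refine le_trans ?_ (PiLp.norm_apply_le _ ⟨1, by omega⟩)
  rw [EuclideanSpace.single, Matrix.toEuclideanCLM_toLp]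
  simp [companion]

end Polynomials

/-! ### Boundedness of the output of a causal system. -/

section Stability

open Polynomial

variable {p q : ℕ}

/-- The forward shift of complex sequences. -/
noncomputable def forwardShift : Module.End ℂ (ℕ → ℂ) := LinearMap.funLeft ℂ ℂ Nat.succ

lemma forwardShift_pow_apply (i : ℕ) (x : ℕ → ℂ) (n : ℕ) :
    (forwardShift ^ i) x n = x (n + i) := by
  induction i generalizing n with
  | zero => rfl
  | succ i ih =>
    rw [pow_succ', Module.End.mul_apply]
    change (forwardShift ^ i) x (n + 1) = _
    rw [ih]
    congr 1
    omega

lemma bounded_of_bounded_sub_mul {c : ℂ} (hc : ‖c‖ < 1) {x : ℕ → ℂ} {K : ℝ}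
    (hx : ∀ n, ‖x (n + 1) - c * x n‖ ≤ K) : ∃ K' : ℝ, ∀ n, ‖x n‖ ≤ K' := by
  have hc' : 0 < 1 - ‖c‖ := by linarith
  refine ⟨max ‖x 0‖ (K / (1 - ‖c‖)), fun n => ?_⟩
  induction n with
  | zero => exact le_max_left _ _
  | succ n ih =>
    set B := max ‖x 0‖ (K / (1 - ‖c‖)) with hB
    have h1 : K ≤ B * (1 - ‖c‖) := (div_le_iff₀ hc').1 (le_max_right _ _)
    have h2 : ‖x (n + 1)‖ ≤ ‖x (n + 1) - c * x n‖ + ‖c * x n‖ := by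
      simpa using norm_add_le (x (n + 1) - c * x n) (c * x n)
    rw [norm_mul] at h2
    have h3 := mul_le_mul_of_nonneg_left ih (norm_nonneg c)
    have h4 := hx n
    linarith

/-- The filter is a composition of first-order recursions with |c| < 1, and undoing each of them
preserves boundedness. -/
lemma bounded_of_bounded_aeval_prod (S : Multiset ℂ) (hS : ∀ c ∈ S, ‖c‖ < 1) (x : ℕ → ℂ)
    (hx : ∃ K : ℝ, ∀ n, ‖aeval forwardShift (S.map fun c => X - C c).prod x n‖ ≤ K) :
    ∃ K : ℝ, ∀ n, ‖x n‖ ≤ K := by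
  induction S using Multiset.induction_on with
  | empty => simpa using hx
  | cons c S ih =>
    refine ih (fun b hb => hS b (Multiset.mem_cons_of_mem hb)) ?_
    obtain ⟨K, hK⟩ := hx
    refine bounded_of_bounded_sub_mul (hS c (Multiset.mem_cons_self _ _)) (K := K) fun n => ?_
    have := hK n
    rw [Multiset.map_cons, Multiset.prod_cons, map_mul, Module.End.mul_apply] at this
    simpa [forwardShift, LinearMap.funLeft_apply] using this

lemma bounded_of_bounded_aeval {P : ℂ[X]} (hP : P.Monic) (hroots : ∀ z, P.eval z = 0 → ‖z‖ < 1)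
    (x : ℕ → ℂ) (hx : ∃ K : ℝ, ∀ n, ‖aeval forwardShift P x n‖ ≤ K) :
    ∃ K : ℝ, ∀ n, ‖x n‖ ≤ K := by
  have hprod : (P.roots.map fun c => X - C c).prod = P :=
    ((IsAlgClosed.splits P).eq_prod_roots_of_monic hP).symm
  refine bounded_of_bounded_aeval_prod P.roots
    (fun c hc => hroots c (mem_roots'.1 hc).2) x ?_
  rwa [hprod]

lemma aeval_reciprocalPoly_apply (v : Param p q) (x : ℕ → ℂ) (n : ℕ) :
    aeval forwardShift (reciprocalPoly v) x n =
      x (n + p) - ∑ j : Fin p, ((v (Sum.inl j) : ℝ) : ℂ) * x (n + (p - 1 - (j : ℕ))) := by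
  simp [reciprocalPoly, forwardShift_pow_apply, Algebra.algebraMap_eq_smul_one]

/-- Boundedness on `[1, ∞)` implies boundedness on every half line of integers. -/
lemma exists_bound_of_le {w : ℤ → ℝ} {K : ℝ} (hw : ∀ k : ℤ, 1 ≤ k → |w k| ≤ K) (r : ℕ) :
    ∃ K' : ℝ, ∀ k : ℤ, -(r : ℤ) ≤ k → |w k| ≤ K' := by
  refine ⟨|K| + ∑ i ∈ Finset.range (r + 1), |w (-(i : ℤ))|, fun k hk => ?_⟩
  have hsum : 0 ≤ ∑ i ∈ Finset.range (r + 1), |w (-(i : ℤ))| :=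
    Finset.sum_nonneg fun _ _ => abs_nonneg _
  rcases le_or_gt 1 k with h1 | h1
  · have := hw k h1
    have := le_abs_self K
    linarith
  · have hmem : (-k).toNat ∈ Finset.range (r + 1) := Finset.mem_range.2 (by omega)
    have := Finset.single_le_sum (f := fun i : ℕ => |w (-(i : ℤ))|)
      (fun _ _ => abs_nonneg _) hmem
    have e : (-((-k).toNat : ℤ)) = k := by omega
    simp only [e] at this
    have := abs_nonneg K
    linarith

lemma norm_regressor_sq (y u : ℤ → ℝ) (k : ℤ) :
    ‖regressor p q y u k‖ ^ 2 =
      ∑ j : Fin p, y (k - 1 - (j : ℕ)) ^ 2 + ∑ j : Fin q, u (k - (j : ℕ)) ^ 2 := by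
  simp [EuclideanSpace.norm_sq_eq, regressor]

lemma exists_norm_regressor_le {θ : Param p q} {h : ℝ} (hh : 0 < h) (hh1 : h < 1)
    (hθ : θ ∈ causalSet p q h) {u y : ℤ → ℝ} (hu : ∃ K : ℝ, ∀ k : ℤ, 1 ≤ k → |u k| ≤ K)
    (hy : IsOutput θ u y) :
    ∃ M₁ : ℝ, 0 < M₁ ∧ ∀ k : ℤ, 1 ≤ k → ‖regressor p q y u k‖ ≤ M₁ := by
  obtain ⟨K, hK⟩ := hu
  obtain ⟨Ku, hKu⟩ := exists_bound_of_le hK q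
  -- With the shift 1 - p, the filter evaluated at n ≥ 0 is the system equation at time n + 1, the
  -- first one being at time 1.
  have hbdd : ∃ K : ℝ, ∀ n : ℕ, ‖((y ((n : ℤ) + 1 - p) : ℝ) : ℂ)‖ ≤ K := by
    refine bounded_of_bounded_aeval (reciprocalPoly_monic θ)
      (fun z hz => (norm_root_reciprocalPoly_lt hh hθ hz).trans hh1)
      (fun n : ℕ => ((y ((n : ℤ) + 1 - p) : ℝ) : ℂ))
      ⟨∑ j : Fin q, |θ (Sum.inr j)| * Ku, fun n => ?_⟩
    have e : aeval forwardShift (reciprocalPoly θ)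
        (fun n : ℕ => ((y ((n : ℤ) + 1 - p) : ℝ) : ℂ)) n =
        ((∑ j : Fin q, θ (Sum.inr j) * u ((n : ℤ) + 1 - (j : ℕ)) : ℝ) : ℂ) := by
      rw [aeval_reciprocalPoly_apply]
      have e1 : ((n + p : ℕ) : ℤ) + 1 - p = n + 1 := by push_cast; ring
      have e2 : ∀ j : Fin p,
          ((n + (p - 1 - (j : ℕ)) : ℕ) : ℤ) + 1 - p = (n : ℤ) + 1 - 1 - (j : ℕ) := by
        intro j
        have := j.2
        omega
      simp only [e1, e2]
      rw [hy ((n : ℤ) + 1) (by omega)]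
      push_cast
      ring
    rw [e, Complex.norm_real, Real.norm_eq_abs]
    refine (Finset.abs_sum_le_sum_abs _ _).trans (Finset.sum_le_sum fun j _ => ?_)
    rw [abs_mul]
    have := j.2
    exact mul_le_mul_of_nonneg_left (hKu _ (by omega)) (abs_nonneg _)
  obtain ⟨Ky, hKy⟩ := hbdd
  have hKy' : ∀ k : ℤ, 1 - (p : ℤ) ≤ k → |y k| ≤ Ky := by
    intro k hk
    have := hKy (k - 1 + p).toNat
    rw [Complex.norm_real, Real.norm_eq_abs] at this
    have e : (((k - 1 + p).toNat : ℕ) : ℤ) + 1 - p = k := by omega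
    rwa [e] at this
  refine ⟨Real.sqrt (p * Ky ^ 2 + q * Ku ^ 2) + 1, by positivity, fun k hk => ?_⟩
  refine le_trans (Real.le_sqrt_of_sq_le ?_) (le_add_of_nonneg_right zero_le_one)
  rw [norm_regressor_sq]
  refine add_le_add ?_ ?_
  · calc _ ≤ ∑ _j : Fin p, Ky ^ 2 := by
          refine Finset.sum_le_sum fun j _ => ?_
          have := j.2
          have := abs_le.1 (hKy' (k - 1 - (j : ℕ)) (by omega))
          exact sq_le_sq' this.1 this.2
      _ = _ := by simp
  · calc _ ≤ ∑ _j : Fin q, Ku ^ 2 := by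
          refine Finset.sum_le_sum fun j _ => ?_
          have := j.2
          have := abs_le.1 (hKu (k - (j : ℕ)) (by omega))
          exact sq_le_sq' this.1 this.2
      _ = _ := by simp

end Stability

/-! ### Transfer of excitation from the input to the regressor. -/

section Excitation

open Polynomial

variable {p q : ℕ}

/-- The backward shift of real sequences. -/
noncomputable def backwardShift : Module.End ℝ (ℤ → ℝ) :=
  LinearMap.funLeft ℝ ℝ (fun k : ℤ => k - 1)

lemma backwardShift_pow_apply (i : ℕ) (x : ℤ → ℝ) (k : ℤ) :
    (backwardShift ^ i) x k = x (k - i) := by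
  induction i generalizing k with
  | zero => simp
  | succ i ih =>
    rw [pow_succ', Module.End.mul_apply]
    change (backwardShift ^ i) x (k - 1) = _
    rw [ih]
    congr 1
    push_cast
    ring

lemma aeval_backwardShift_apply {P : ℝ[X]} {n : ℕ} (hP : P.natDegree < n) (x : ℤ → ℝ) (k : ℤ) :
    aeval backwardShift P x k = ∑ i ∈ Finset.range n, P.coeff i * x (k - i) := by
  rw [aeval_eq_sum_range' hP]
  simp [backwardShift_pow_apply, Finset.sum_apply]

/-- The polynomial with coefficients `v_0, …, v_{n-1}`. -/
noncomputable def coeffPoly {R : Type*} [Semiring R] {n : ℕ} (v : Fin n → R) : R[X] :=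
  ∑ j : Fin n, C (v j) * X ^ (j : ℕ)

lemma degree_coeffPoly_lt {R : Type*} [Semiring R] {n : ℕ} (v : Fin n → R) :
    (coeffPoly v).degree < ((n : ℕ) : WithBot ℕ) := by
  refine (degree_sum_le _ _).trans_lt ?_
  rw [Finset.sup_lt_iff (by exact WithBot.bot_lt_coe n)]
  intro j _
  exact (degree_C_mul_X_pow_le _ _).trans_lt (by exact_mod_cast j.2)

lemma coeff_coeffPoly {R : Type*} [Semiring R] {n : ℕ} (v : Fin n → R) (j : Fin n) :
    (coeffPoly v).coeff j = v j := by
  rw [coeffPoly, finsetSum_coeff, Finset.sum_eq_single j]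
  · simp
  · intro b _ hb
    rw [coeff_C_mul_X_pow, if_neg]
    exact fun h => hb (Fin.ext h.symm)
  · simp

lemma coeffPoly_add {R : Type*} [Semiring R] {n : ℕ} (v w : Fin n → R) :
    coeffPoly (v + w) = coeffPoly v + coeffPoly w := by
  simp [coeffPoly, add_mul, Finset.sum_add_distrib]

lemma coeffPoly_smul {R : Type*} [CommSemiring R] {n : ℕ} (c : R) (v : Fin n → R) :
    coeffPoly (c • v) = c • coeffPoly v := by
  simp [coeffPoly, Finset.smul_sum, smul_eq_C_mul, mul_assoc]

lemma aeval_coeffPoly_apply {n : ℕ} (v : Fin n → ℝ) (x : ℤ → ℝ) (k : ℤ) :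
    aeval backwardShift (coeffPoly v) x k = ∑ j : Fin n, v j * x (k - (j : ℕ)) := by
  simp [coeffPoly, backwardShift_pow_apply, Algebra.algebraMap_eq_smul_one, Finset.sum_apply]

/-- The real polynomial `1 - z A(z)`. -/
noncomputable def arRealPoly (θ : Param p q) : ℝ[X] :=
  1 - X * coeffPoly fun j => θ (Sum.inl j)

/-- The real polynomial `B(z)`. -/
noncomputable def maRealPoly (θ : Param p q) : ℝ[X] := coeffPoly fun j => θ (Sum.inr j)

lemma map_arRealPoly (θ : Param p q) : (arRealPoly θ).map (algebraMap ℝ ℂ) = arPoly θ := by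
  simp [arRealPoly, arPoly, coeffPoly, Polynomial.map_sum, Finset.mul_sum, pow_succ', mul_left_comm]

lemma map_maRealPoly (θ : Param p q) : (maRealPoly θ).map (algebraMap ℝ ℂ) = maPoly θ := by
  simp [maRealPoly, maPoly, coeffPoly, Polynomial.map_sum]

/-- The polynomial `z X₁(z) B(z) + (1 - z A(z)) X₂(z)`, where `X₁` and `X₂` have the coefficients
`x`: filtering `⟪φ_k, x⟫` by `1 - z A(z)` gives this filter of the input. -/
noncomputable def crossPoly (θ x : Param p q) : ℝ[X] :=
  X * coeffPoly (fun j => x (Sum.inl j)) * maRealPoly θ +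
    arRealPoly θ * coeffPoly fun j => x (Sum.inr j)

lemma degree_arRealPoly_le (θ : Param p q) : (arRealPoly θ).degree ≤ ((p : ℕ) : WithBot ℕ) := by
  refine (degree_sub_le _ _).trans (max_le (degree_one_le.trans (by exact_mod_cast p.zero_le)) ?_)
  rcases eq_or_ne (coeffPoly fun j => θ (Sum.inl j)) 0 with h0 | h0
  · simp [h0]
  rw [mul_comm, degree_mul_X, degree_eq_natDegree h0]
  have := degree_coeffPoly_lt fun j => θ (Sum.inl j)
  rw [degree_eq_natDegree h0] at this
  exact_mod_cast this

lemma coeff_arRealPoly_last (θ : Param p q) (hp : 0 < p) :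
    (arRealPoly θ).coeff p = - θ (Sum.inl ⟨p - 1, Nat.sub_one_lt_of_lt hp⟩) := by
  obtain ⟨n, rfl⟩ : ∃ n, p = n + 1 := ⟨p - 1, by omega⟩
  rw [arRealPoly, coeff_sub, coeff_X_mul, coeff_one, if_neg (by omega), zero_sub]
  congr 1
  exact coeff_coeffPoly (fun j => θ (Sum.inl j)) ⟨n, by omega⟩

lemma coeff_zero_arRealPoly (θ : Param p q) : (arRealPoly θ).coeff 0 = 1 := by
  simp [arRealPoly]

lemma isCoprime_arRealPoly_maRealPoly {θ : Param p q}
    (hθ : ∀ z : ℂ, ¬ ((arPoly θ).eval z = 0 ∧ (maPoly θ).eval z = 0)) :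
    IsCoprime (arRealPoly θ) (maRealPoly θ) := by
  rw [isCoprime_iff_aeval_ne_zero_of_isAlgClosed ℝ ℂ]
  intro z
  rw [← not_and_or]
  have := hθ z
  rwa [← map_arRealPoly, ← map_maRealPoly, eval_map_algebraMap, eval_map_algebraMap] at this

lemma isCoprime_arRealPoly_X (θ : Param p q) : IsCoprime (arRealPoly θ) X :=
  ⟨1, coeffPoly fun j => θ (Sum.inl j), by rw [arRealPoly]; ring⟩

/-- The polynomial 1 - zA divides zX₁B and is coprime to z and to B, so it divides X₁. Its degree is
exactly p because a_p ≠ 0, whereas deg X₁ < p; hence X₁ = 0, and then X₂ = 0. -/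
lemma crossPoly_eq_zero {θ x : Param p q} (hp : 0 < p)
    (hθ_order : θ (Sum.inl ⟨p - 1, Nat.sub_one_lt_of_lt hp⟩) ≠ 0)
    (hθ : ∀ z : ℂ, ¬ ((arPoly θ).eval z = 0 ∧ (maPoly θ).eval z = 0))
    (hx : crossPoly θ x = 0) : x = 0 := by
  have hcoeff : (arRealPoly θ).coeff p ≠ 0 := by
    rw [coeff_arRealPoly_last θ hp]; exact neg_ne_zero.2 hθ_order
  have h0 : arRealPoly θ ≠ 0 := fun h => hcoeff (by rw [h, coeff_zero])
  have hdvd : arRealPoly θ ∣ coeffPoly fun j => x (Sum.inl j) := by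
    have h1 : arRealPoly θ ∣ X * coeffPoly (fun j => x (Sum.inl j)) * maRealPoly θ :=
      ⟨-coeffPoly fun j => x (Sum.inr j), by
        rw [crossPoly] at hx; rw [mul_neg]; exact eq_neg_of_add_eq_zero_left hx⟩
    exact (isCoprime_arRealPoly_X θ).dvd_of_dvd_mul_left
      ((isCoprime_arRealPoly_maRealPoly hθ).dvd_of_dvd_mul_right h1)
  have hX1 : (coeffPoly fun j => x (Sum.inl j)) = 0 := by
    by_contra hne
    have h1 := degree_le_of_dvd hdvd hne
    have h2 := le_degree_of_ne_zero hcoeff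
    exact absurd (h2.trans h1) (not_le.2 (degree_coeffPoly_lt _))
  have hX2 : (coeffPoly fun j => x (Sum.inr j)) = 0 := by
    rw [crossPoly, hX1, mul_zero, zero_mul, zero_add] at hx
    exact (mul_eq_zero.1 hx).resolve_left h0
  ext j
  rcases j with j | j
  · have := coeff_coeffPoly (fun j => x (Sum.inl j)) j
    rw [hX1, coeff_zero] at this
    exact this.symm
  · have := coeff_coeffPoly (fun j => x (Sum.inr j)) j
    rw [hX2, coeff_zero] at this
    exact this.symm

lemma natDegree_crossPoly_lt (θ x : Param p q) (hp : 0 < p) :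
    (crossPoly θ x).natDegree < p + q := by
  refine lt_of_le_of_lt (natDegree_le_of_degree_le (n := p + q - 1) ?_) (by omega)
  rcases Nat.eq_zero_or_pos q with rfl | hq
  · simp [crossPoly, maRealPoly, coeffPoly]
  have hle : ∀ {n : ℕ} (_ : 0 < n) (v : Fin n → ℝ), (coeffPoly v).natDegree ≤ n - 1 := by
    intro n hn v
    refine natDegree_le_of_degree_le ?_
    rcases eq_or_ne (coeffPoly v) 0 with h0 | h0
    · simp [h0]
    have := degree_coeffPoly_lt v
    rw [degree_eq_natDegree h0] at this ⊢
    have h3 : (coeffPoly v).natDegree < n := by exact_mod_cast this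
    exact_mod_cast (by omega : (coeffPoly v).natDegree ≤ n - 1)
  have ha : (arRealPoly θ).natDegree ≤ p := natDegree_le_of_degree_le (degree_arRealPoly_le θ)
  refine degree_le_of_natDegree_le ((natDegree_add_le _ _).trans (max_le ?_ ?_))
  · refine natDegree_mul_le.trans ?_
    have h1 : (X * coeffPoly fun j => x (Sum.inl j)).natDegree ≤ 1 + (p - 1) :=
      natDegree_mul_le.trans (add_le_add natDegree_X_le (hle hp _))
    have h2 : (maRealPoly θ).natDegree ≤ q - 1 := hle hq _
    omega
  · refine natDegree_mul_le.trans ?_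
    have h2 : (coeffPoly fun j => x (Sum.inr j)).natDegree ≤ q - 1 := hle hq _
    omega

/-- The coefficients of `crossPoly θ x`, as a linear function of `x`. -/
noncomputable def crossCoeff (θ : Param p q) : Param p q →ₗ[ℝ] EuclideanSpace ℝ (Fin (p + q)) where
  toFun x := WithLp.toLp 2 fun i => (crossPoly θ x).coeff i
  map_add' x y := by
    ext i
    have e1 : (coeffPoly fun j => (x + y) (Sum.inl j)) =
      coeffPoly (fun j => x (Sum.inl j)) + coeffPoly fun j => y (Sum.inl j) := coeffPoly_add _ _
    have e2 : (coeffPoly fun j => (x + y) (Sum.inr j)) =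
      coeffPoly (fun j => x (Sum.inr j)) + coeffPoly fun j => y (Sum.inr j) := coeffPoly_add _ _
    have : crossPoly θ (x + y) = crossPoly θ x + crossPoly θ y := by
      rw [crossPoly, e1, e2, crossPoly, crossPoly]; ring
    simp [this]
  map_smul' c x := by
    ext i
    have e1 : (coeffPoly fun j => (c • x) (Sum.inl j)) =
      c • coeffPoly (fun j => x (Sum.inl j)) := coeffPoly_smul _ _
    have e2 : (coeffPoly fun j => (c • x) (Sum.inr j)) =
      c • coeffPoly (fun j => x (Sum.inr j)) := coeffPoly_smul _ _
    have : crossPoly θ (c • x) = c • crossPoly θ x := by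
      rw [crossPoly, e1, e2, crossPoly, smul_eq_C_mul, smul_eq_C_mul, smul_eq_C_mul]; ring
    simp [this]

lemma aeval_crossPoly_eq_inner (θ x : Param p q) (hp : 0 < p) (u : ℤ → ℝ) (k : ℤ) :
    aeval backwardShift (crossPoly θ x) u k =
      inner ℝ (inputWindow (p + q) u k) (crossCoeff θ x) := by
  rw [aeval_backwardShift_apply (natDegree_crossPoly_lt θ x hp), Finset.sum_range]
  simp [crossCoeff, inputWindow, PiLp.inner_apply]

/-- An injective linear map on a finite-dimensional space is bounded below. -/
lemma exists_crossCoeff_lower_bound {θ : Param p q} (hp : 0 < p)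
    (hθ_order : θ (Sum.inl ⟨p - 1, Nat.sub_one_lt_of_lt hp⟩) ≠ 0)
    (hθ : ∀ z : ℂ, ¬ ((arPoly θ).eval z = 0 ∧ (maPoly θ).eval z = 0)) :
    ∃ c : ℝ, 0 < c ∧ ∀ x, c * ‖x‖ ^ 2 ≤ ‖crossCoeff θ x‖ ^ 2 := by
  have hker : LinearMap.ker (crossCoeff θ) = ⊥ := by
    rw [LinearMap.ker_eq_bot']
    intro x hx
    refine crossPoly_eq_zero hp hθ_order hθ ?_
    ext i
    rw [coeff_zero]
    rcases lt_or_ge i (p + q) with hi | hi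
    · have := congrArg (fun v => v ⟨i, hi⟩) hx
      simpa [crossCoeff] using this
    · exact coeff_eq_zero_of_natDegree_lt ((natDegree_crossPoly_lt θ x hp).trans_le hi)
  obtain ⟨K, hK, hanti⟩ := (crossCoeff θ).exists_antilipschitzWith hker
  have hK' : (0 : ℝ) < K := hK
  refine ⟨1 / (K : ℝ) ^ 2, by positivity, fun x => ?_⟩
  have := hanti.le_mul_norm_sub x 0
  simp only [map_zero, add_zero, norm_neg] at this
  rw [div_mul_eq_mul_div, one_mul, div_le_iff₀ (by positivity), ← mul_pow, mul_comm]
  exact pow_le_pow_left₀ (norm_nonneg _) this 2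

lemma inner_regressor (y u : ℤ → ℝ) (k : ℤ) (x : Param p q) :
    inner ℝ (regressor p q y u k) x =
      ∑ j : Fin p, x (Sum.inl j) * y (k - 1 - (j : ℕ)) +
        ∑ j : Fin q, x (Sum.inr j) * u (k - (j : ℕ)) := by
  simp [PiLp.inner_apply, regressor]

/-- Polynomials in the shift commute, so the two sides differ by zX₁ applied to the residual `r` of
the system equation. The residual vanishes from time 1 on, and zX₁ looks back at most p steps, hence
the start at p + 1. -/
lemma aeval_arRealPoly_inner_regressor {θ : Param p q} {u y : ℤ → ℝ} (hy : IsOutput θ u y)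
    (x : Param p q) {k : ℤ} (hk : (p : ℤ) + 1 ≤ k) :
    aeval backwardShift (arRealPoly θ) (fun l => inner ℝ (regressor p q y u l) x) k =
      aeval backwardShift (crossPoly θ x) u k := by
  set L := backwardShift
  set a := arRealPoly θ
  set b := maRealPoly θ
  set x₁ := coeffPoly fun j => x (Sum.inl j)
  set x₂ := coeffPoly fun j => x (Sum.inr j)
  set r : ℤ → ℝ := aeval L a y - aeval L b u with hr
  have hr0 : ∀ l : ℤ, 1 ≤ l → r l = 0 := by
    intro l hl
    have e1 : aeval L a y l = y l - ∑ j : Fin p, θ (Sum.inl j) * y (l - 1 - (j : ℕ)) := by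
      have e2 : aeval L (X * coeffPoly fun j => θ (Sum.inl j)) y l =
          aeval L (coeffPoly fun j => θ (Sum.inl j)) y (l - 1) := by
        rw [map_mul, Module.End.mul_apply, aeval_X]; rfl
      rw [aeval_coeffPoly_apply] at e2
      rw [← e2]
      simp [a, arRealPoly]
    have e3 : aeval L b u l = ∑ j : Fin q, θ (Sum.inr j) * u (l - (j : ℕ)) :=
      aeval_coeffPoly_apply _ _ _
    rw [hr, Pi.sub_apply, e1, hy l hl, e3]
    ring
  have hw : (fun l => inner ℝ (regressor p q y u l) x) = aeval L (X * x₁) y + aeval L x₂ u := by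
    funext l
    have e2 : aeval L (X * x₁) y l = aeval L x₁ y (l - 1) := by
      rw [map_mul, Module.End.mul_apply, aeval_X]; rfl
    rw [inner_regressor, Pi.add_apply, e2, aeval_coeffPoly_apply, aeval_coeffPoly_apply]
  have hmain : aeval L a (aeval L (X * x₁) y + aeval L x₂ u) =
      aeval L (crossPoly θ x) u + aeval L (X * x₁) r := by
    have h1 : crossPoly θ x = X * x₁ * b + a * x₂ := rfl
    rw [hr, map_add, map_sub, ← Module.End.mul_apply, ← Module.End.mul_apply,
      ← Module.End.mul_apply, ← Module.End.mul_apply, ← map_mul, ← map_mul, ← map_mul, ← map_mul,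
      h1, map_add, LinearMap.add_apply, mul_comm a (X * x₁)]
    abel
  have e2 : aeval L (X * x₁) r k = aeval L x₁ r (k - 1) := by
    rw [map_mul, Module.End.mul_apply, aeval_X]; rfl
  rw [hw, hmain, Pi.add_apply, e2, aeval_coeffPoly_apply, Finset.sum_eq_zero, add_zero]
  intro j _
  have := j.2
  rw [hr0 _ (by omega), mul_zero]

lemma exists_excites_regressor {θ : Param p q} (hp : 0 < p)
    (hθ_order : θ (Sum.inl ⟨p - 1, Nat.sub_one_lt_of_lt hp⟩) ≠ 0)
    (hθ : ∀ z : ℂ, ¬ ((arPoly θ).eval z = 0 ∧ (maPoly θ).eval z = 0))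
    {u y : ℤ → ℝ} (hy : IsOutput θ u y) {m : ℕ} (hm : 0 < m) {δ₁ : ℝ} (hδ₁ : 0 < δ₁)
    (hu : Excites (inputWindow (p + q) u) m δ₁) :
    ∃ δ : ℝ, 0 < δ ∧ Excites (regressor p q y u) (p + m) δ := by
  obtain ⟨c, hc, hcross⟩ := exists_crossCoeff_lower_bound hp hθ_order hθ
  set K : ℝ := ∑ i ∈ Finset.range (p + 1), (arRealPoly θ).coeff i ^ 2 with hK
  have hK1 : 1 ≤ K := by
    have := Finset.single_le_sum (f := fun i => (arRealPoly θ).coeff i ^ 2)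
      (fun _ _ => sq_nonneg _) (Finset.mem_range.2 (Nat.succ_pos p))
    simpa [coeff_zero_arRealPoly] using this
  have hK0 : 0 < K := by linarith
  -- Cauchy–Schwarz for a filter with p + 1 taps costs `K * (p + 1)`; the average over the enlarged
  -- window costs `p + m`. The window gains p because the input is tested from time k + p on.
  refine ⟨δ₁ * c / (K * (p + 1) * (p + m)), by positivity, fun k hk x => ?_⟩
  set w : ℤ → ℝ := fun l => inner ℝ (regressor p q y u l) x with hwdef
  set S : ℝ := ∑ i ∈ Finset.range (p + m), w (k + (i : ℤ)) ^ 2 with hS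
  have hdeg : (arRealPoly θ).natDegree < p + 1 :=
    Nat.lt_succ_of_le (natDegree_le_of_degree_le (degree_arRealPoly_le θ))
  have hterm : ∀ i ∈ Finset.range m,
      (inner ℝ (inputWindow (p + q) u (k + p + (i : ℤ))) (crossCoeff θ x)) ^ 2 ≤
        K * ((p + 1) * S) := by
    intro i hi
    have him := Finset.mem_range.1 hi
    rw [← aeval_crossPoly_eq_inner θ x hp, ← aeval_arRealPoly_inner_regressor hy x (by omega),
      aeval_backwardShift_apply hdeg]
    refine (Finset.sum_mul_sq_le_sq_mul_sq _ _ _).trans ?_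
    refine mul_le_mul_of_nonneg_left ?_ hK0.le
    calc _ ≤ ∑ _j ∈ Finset.range (p + 1), S := by
          refine Finset.sum_le_sum fun j hj => ?_
          have hj' := Finset.mem_range.1 hj
          have e : k + p + (i : ℤ) - (j : ℤ) = k + ((p + i - j : ℕ) : ℤ) := by omega
          rw [e]
          exact Finset.single_le_sum (f := fun i : ℕ => w (k + (i : ℤ)) ^ 2)
            (fun _ _ => sq_nonneg _) (Finset.mem_range.2 (by omega))
      _ = _ := by simp
  have h1 := hu (k + p) (by omega) (crossCoeff θ x)
  have h2 := (Finset.sum_le_sum hterm)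
  rw [Finset.sum_const, Finset.card_range, nsmul_eq_mul] at h2
  have hm' : (0 : ℝ) < m := by exact_mod_cast hm
  have h3 : δ₁ * ‖crossCoeff θ x‖ ^ 2 ≤ K * ((p + 1) * S) := by
    refine h1.trans ?_
    rw [one_div, inv_mul_le_iff₀ hm']
    exact h2
  have h4 : δ₁ * (c * ‖x‖ ^ 2) ≤ K * ((p + 1) * S) :=
    (mul_le_mul_of_nonneg_left (hcross x) hδ₁.le).trans h3
  change _ ≤ (1 / ((p + m : ℕ) : ℝ)) * S
  have hpos : (0 : ℝ) < K * (p + 1) * (p + m) := by positivity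
  rw [div_mul_eq_mul_div, div_le_iff₀ hpos]
  push_cast
  have e : 1 / ((p : ℝ) + m) * S * (K * (p + 1) * (p + m)) = K * ((p + 1) * S) := by
    have : (p : ℝ) + m ≠ 0 := by positivity
    field_simp
  rw [e]
  linarith

end Excitation

/-! ### Small gain estimate and a deterministic Lyapunov recursion. -/

section RealSequences

/-- Each weight drops by one under the shift, which leaves the unweighted sum. This is the increment
of the storage function. -/
lemma sum_storage_sub_sum_storage_shift (n : ℕ) (x : ℕ → ℝ) :
    ∑ j ∈ Finset.range n, ((n : ℝ) - j) * x j - ∑ j ∈ Finset.range n, ((n : ℝ) - j) * x (j + 1) =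
      n * x 0 - ∑ j ∈ Finset.range n, x (j + 1) := by
  induction n with
  | zero => simp
  | succ n ih =>
    have h : ∀ w : ℕ → ℝ, ∑ j ∈ Finset.range (n + 1), (((n + 1 : ℕ) : ℝ) - j) * w j =
        ∑ j ∈ Finset.range n, ((n : ℝ) - j) * w j + ∑ j ∈ Finset.range (n + 1), w j := by
      intro w
      rw [Finset.sum_range_succ, Finset.sum_range_succ (fun j => w j), ← add_assoc,
        ← Finset.sum_add_distrib]
      congr 1
      · exact Finset.sum_congr rfl fun j _ => by push_cast; ring
      · push_cast; ring
    rw [h x, h fun j => x (j + 1), Finset.sum_range_succ' x n,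
      Finset.sum_range_succ (fun j => x (j + 1)) n]
    push_cast
    linarith

/-- A small gain estimate with supply rate: if `η ≈ z + β` and `β² ≤ s² η²` up to the increment `Δ`
of a storage function, then `fM |z| |β|` is dominated by `fm z²` whenever `fM s / (1 - s) < fm`. -/
lemma exists_small_gain {s fm fM : ℝ} (hs : 0 < s) (hs1 : s < 1) (hfM : 0 ≤ fM)
    (hgain : fM * (s / (1 - s)) < fm) :
    ∃ c₁ c₂ c₃ : ℝ, 0 < c₁ ∧ 0 ≤ c₂ ∧ 0 ≤ c₃ ∧ ∀ z β η Δ ρ : ℝ, 0 ≤ ρ →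
      η ^ 2 ≤ (z + β) ^ 2 + ρ → β ^ 2 ≤ s ^ 2 * η ^ 2 - Δ →
      -fm * z ^ 2 + fM * (|z| * |β|) ≤ -c₁ * (z ^ 2 + η ^ 2) - c₂ * Δ + c₃ * ρ := by
  have hs' : 0 < 1 - s := by linarith
  obtain ⟨t, ht, htd⟩ : ∃ t : ℝ, 0 < t ∧ fm - fM * (s / (1 - s)) = 2 * t :=
    ⟨(fm - fM * (s / (1 - s))) / 2, by linarith, by ring⟩
  -- Here 2t is the slack of the gain condition: one t z² is kept for z², the other pays for t (1 -
  -- s)² η² through `e4`. The constants `c₂` and `c₃` collect the coefficients of Δ and ρ from `e3`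
  -- and `e4`.
  refine ⟨t * (1 - s) ^ 2, t * (1 - s) ^ 2 / (s * (1 - s)) + fM / (2 * s),
    t * (1 - s) ^ 2 / (s * (1 - s)) + fM / (2 * s) + t * (1 - s) ^ 2, by positivity, by positivity,
    by positivity, fun z β η Δ ρ hρ h1 h2 => ?_⟩
  have e1 : (z + β) ^ 2 ≤ z ^ 2 / (1 - s) + β ^ 2 / s := by
    rw [div_add_div _ _ hs'.ne' hs.ne', le_div_iff₀ (by positivity)]
    nlinarith [sq_nonneg (s * z - (1 - s) * β)]
  have e2 : (1 - s) * β ^ 2 ≤ s ^ 2 / (1 - s) * z ^ 2 + (ρ - Δ) := by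
    have h3 : s ^ 2 * η ^ 2 ≤ s ^ 2 * (z ^ 2 / (1 - s) + β ^ 2 / s + ρ) :=
      mul_le_mul_of_nonneg_left (by linarith) (sq_nonneg s)
    have h4 : s ^ 2 * (z ^ 2 / (1 - s) + β ^ 2 / s + ρ) =
        s ^ 2 / (1 - s) * z ^ 2 + s * β ^ 2 + s ^ 2 * ρ := by
      field_simp
    have h5 : s ^ 2 * ρ ≤ ρ := mul_le_of_le_one_left hρ (pow_le_one₀ hs.le hs1.le)
    linarith
  have e3 : |z| * |β| ≤ s / (1 - s) * z ^ 2 + (ρ - Δ) / (2 * s) := by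
    have h3 : 2 * s * (|z| * |β|) ≤ s ^ 2 / (1 - s) * z ^ 2 + (1 - s) * β ^ 2 := by
      rw [div_mul_eq_mul_div, div_add' _ _ _ hs'.ne', le_div_iff₀ hs', ← sq_abs z, ← sq_abs β]
      nlinarith [sq_nonneg (s * |z| - (1 - s) * |β|)]
    have h4 : s / (1 - s) * z ^ 2 + (ρ - Δ) / (2 * s) =
        (2 * (s ^ 2 / (1 - s) * z ^ 2) + (ρ - Δ)) / (2 * s) := by
      field_simp
    rw [h4, le_div_iff₀ (by positivity)]
    linarith
  have e4 : η ^ 2 * (1 - s) ^ 2 ≤ z ^ 2 + (1 - s) ^ 2 / (s * (1 - s)) * (ρ - Δ) +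
      (1 - s) ^ 2 * ρ := by
    have h3 : β ^ 2 / s * (1 - s) ^ 2 ≤
        (s ^ 2 / (1 - s) * z ^ 2 + (ρ - Δ)) * ((1 - s) / s) := by
      calc β ^ 2 / s * (1 - s) ^ 2 = ((1 - s) * β ^ 2) * ((1 - s) / s) := by ring
        _ ≤ _ := mul_le_mul_of_nonneg_right e2 (by positivity)
    have h4 : η ^ 2 * (1 - s) ^ 2 ≤ (z ^ 2 / (1 - s) + β ^ 2 / s + ρ) * (1 - s) ^ 2 :=
      mul_le_mul_of_nonneg_right (by linarith) (sq_nonneg _)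
    have h5 : (s ^ 2 / (1 - s) * z ^ 2 + (ρ - Δ)) * ((1 - s) / s) +
        (z ^ 2 / (1 - s) + ρ) * (1 - s) ^ 2 =
        z ^ 2 + (1 - s) ^ 2 / (s * (1 - s)) * (ρ - Δ) + (1 - s) ^ 2 * ρ := by
      field_simp
      ring
    linarith
  have e5 := mul_le_mul_of_nonneg_left e3 hfM
  have e6 := mul_le_mul_of_nonneg_left e4 ht.le
  have e7 : t * (1 - s) ^ 2 * z ^ 2 ≤ t * z ^ 2 := by
    refine mul_le_mul_of_nonneg_right ?_ (sq_nonneg z)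
    have : (1 - s) ^ 2 ≤ 1 := pow_le_one₀ hs'.le (by linarith)
    nlinarith
  have e8 : fm = fM * (s / (1 - s)) + 2 * t := by linarith
  have e9 : fM * ((ρ - Δ) / (2 * s)) = fM / (2 * s) * (ρ - Δ) := by ring
  have e10 : t * ((1 - s) ^ 2 / (s * (1 - s)) * (ρ - Δ)) =
      t * (1 - s) ^ 2 / (s * (1 - s)) * (ρ - Δ) := by ring
  rw [e8]
  nlinarith

lemma summable_div_shift {X : ℕ → ℝ} (hX : ∀ k, 0 ≤ X k) (hs : Summable fun k : ℕ => X k / k)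
    (i j : ℕ) : Summable fun k : ℕ => X (k + i - j) / k := by
  have h1 : Summable fun n : ℕ => (i + 1 : ℝ) * (X (n + (1 + i)) / ((n + (1 + i) : ℕ) : ℝ)) :=
    ((summable_nat_add_iff (f := fun k : ℕ => X k / (k : ℝ)) (1 + i)).2 hs).mul_left _
  -- Dropping the first j + 1 terms makes the truncated subtraction exact and the denominators
  -- positive.
  rw [← summable_nat_add_iff (j + 1)]
  refine Summable.of_nonneg_of_le (fun n => div_nonneg (hX _) (Nat.cast_nonneg _)) (fun n => ?_) h1
  have e : n + (j + 1) + i - j = n + (1 + i) := by omega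
  rw [e, mul_div_assoc', div_le_div_iff₀ (by positivity) (by positivity)]
  have h2 : ((n + (1 + i) : ℕ) : ℝ) ≤ (i + 1) * ((n + (j + 1) : ℕ) : ℝ) := by
    push_cast
    have h3 : (0 : ℝ) ≤ i * (n + j) := by positivity
    have h4 : (0 : ℝ) ≤ j := Nat.cast_nonneg j
    nlinarith
  calc X (n + (1 + i)) * ((n + (1 + i) : ℕ) : ℝ)
      ≤ X (n + (1 + i)) * ((i + 1) * ((n + (j + 1) : ℕ) : ℝ)) :=
        mul_le_mul_of_nonneg_left h2 (hX _)
    _ = _ := by ring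

/-- A Lyapunov recursion with step sizes `1/k` whose supply `Z + H` controls the Lyapunov function
over windows of bounded length. -/
lemma tendsto_zero_of_lyapunov {V Z H G : ℕ → ℝ} {a b c B : ℝ} {k₀ N p : ℕ}
    (hV : ∀ k, 0 ≤ V k) (hZ : ∀ k, 0 ≤ Z k) (hH : ∀ k, 0 ≤ H k) (hG : ∀ k, k₀ ≤ k → |G k| ≤ B)
    (ha : 0 < a) (hb : 0 ≤ b) (hk₀ : 0 < k₀)
    (hstep : ∀ k, k₀ ≤ k → V (k + 1) ≤ V k +
      (1 / ((k : ℝ) + 1)) * (-a * (Z (k + 1) + H (k + 1)) - (G (k + 1) - G k)) +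
        b / ((k : ℝ) + 1) ^ 2)
    (hwin : ∀ k, k₀ ≤ k → V k ≤
      ∑ i ∈ Finset.range N, (c * Z (k + 1 + i) + ∑ j ∈ Finset.range p, c * H (k + i - j)) +
        c / k) :
    Tendsto V atTop (𝓝 0) := by
  have hB : 0 ≤ B := (abs_nonneg _).trans (hG k₀ le_rfl)
  -- Summation by parts: G/k absorbs the increments of G, the shift by B makes G + B ≥ 0 so that the
  -- leftover has a sign, and b/k absorbs the b/(k+1)² terms. Thus Y decreases.
  set Y : ℕ → ℝ := fun k => V k + (G k + (B + b)) / k with hY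
  have hYstep : ∀ k, k₀ ≤ k →
      Y (k + 1) + a * ((Z (k + 1) + H (k + 1)) / ((k + 1 : ℕ) : ℝ)) ≤ Y k := by
    intro k hk
    have hk0 : (0 : ℝ) < k := by exact_mod_cast hk₀.trans_le hk
    have h1 := hstep k hk
    have h2 : b / ((k : ℝ) + 1) ^ 2 ≤ b * (1 / k - 1 / ((k : ℝ) + 1)) := by
      rw [div_eq_mul_one_div]
      refine mul_le_mul_of_nonneg_left ?_ hb
      rw [div_sub_div _ _ hk0.ne' (by positivity), div_le_div_iff₀ (by positivity) (by positivity)]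
      nlinarith
    have h3 : 0 ≤ (G k + B) * (1 / k - 1 / ((k : ℝ) + 1)) := by
      refine mul_nonneg (by have := (abs_le.1 (hG k hk)).1; linarith) (sub_nonneg.2 ?_)
      exact one_div_le_one_div_of_le hk0 (by linarith)
    simp only [hY]
    push_cast
    have e : V k + (G k + (B + b)) / k - (V (k + 1) + (G (k + 1) + (B + b)) / ((k : ℝ) + 1) +
        a * ((Z (k + 1) + H (k + 1)) / ((k : ℝ) + 1))) =
        (V k + (1 / ((k : ℝ) + 1)) * (-a * (Z (k + 1) + H (k + 1)) - (G (k + 1) - G k)) +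
          b * (1 / k - 1 / ((k : ℝ) + 1)) - V (k + 1)) +
          (G k + B) * (1 / k - 1 / ((k : ℝ) + 1)) := by
      field_simp
      ring
    linarith
  have hY0 : ∀ k, k₀ ≤ k → 0 ≤ Y k := by
    intro k hk
    have := (abs_le.1 (hG k hk)).1
    exact add_nonneg (hV k) (div_nonneg (by linarith) (Nat.cast_nonneg _))
  have hT0 : ∀ k : ℕ, 0 ≤ (Z k + H k) / (k : ℝ) := fun k =>
    div_nonneg (add_nonneg (hZ k) (hH k)) (Nat.cast_nonneg _)
  have hsumT : Summable fun k : ℕ => (Z k + H k) / (k : ℝ) := by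
    rw [← summable_nat_add_iff (k₀ + 1)]
    refine summable_of_sum_range_le (c := Y k₀ / a) (fun n => hT0 _) fun n => ?_
    rw [le_div_iff₀ ha, mul_comm]
    have : a * ∑ i ∈ Finset.range n,
        (Z (i + (k₀ + 1)) + H (i + (k₀ + 1))) / ((i + (k₀ + 1) : ℕ) : ℝ) + Y (k₀ + n) ≤ Y k₀ := by
      induction n with
      | zero => simp
      | succ n ih =>
        have h1 := hYstep (k₀ + n) (by omega)
        have e : n + (k₀ + 1) = k₀ + n + 1 := by omega
        rw [Finset.sum_range_succ, mul_add, e]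
        rw [← add_assoc k₀ n 1]
        linarith
    have := hY0 (k₀ + n) (by omega)
    linarith
  have hsumZ : Summable fun k : ℕ => Z k / (k : ℝ) :=
    Summable.of_nonneg_of_le (fun k => div_nonneg (hZ k) (Nat.cast_nonneg _))
      (fun k => div_le_div_of_nonneg_right (by linarith [hH k]) (Nat.cast_nonneg _)) hsumT
  have hsumH : Summable fun k : ℕ => H k / (k : ℝ) :=
    Summable.of_nonneg_of_le (fun k => div_nonneg (hH k) (Nat.cast_nonneg _))
      (fun k => div_le_div_of_nonneg_right (by linarith [hZ k]) (Nat.cast_nonneg _)) hsumT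
  have hsumV : Summable fun k : ℕ => V k / (k : ℝ) := by
    have hbig : Summable fun k : ℕ => (∑ i ∈ Finset.range N, (c * (Z (k + (1 + i) - 0) / k) +
        ∑ j ∈ Finset.range p, c * (H (k + i - j) / k))) + c * (1 / (k : ℝ) ^ 2) := by
      refine Summable.add (summable_sum fun i _ => Summable.add ?_ (summable_sum fun j _ => ?_)) ?_
      · exact (summable_div_shift hZ hsumZ _ _).mul_left c
      · exact (summable_div_shift hH hsumH _ _).mul_left c
      · exact (Real.summable_one_div_nat_pow.2 one_lt_two).mul_left c
    rw [← summable_nat_add_iff k₀] at hbig ⊢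
    refine Summable.of_nonneg_of_le (fun n => div_nonneg (hV _) (Nat.cast_nonneg _)) (fun n => ?_)
      hbig
    have h1 := hwin (n + k₀) (by omega)
    refine (div_le_div_of_nonneg_right h1 (Nat.cast_nonneg _)).trans (le_of_eq ?_)
    rw [add_div, Finset.sum_div]
    congr 1
    · refine Finset.sum_congr rfl fun i _ => ?_
      rw [add_div, Finset.sum_div, mul_div_assoc, Nat.sub_zero, ← add_assoc (n + k₀)]
      congr 1
      exact Finset.sum_congr rfl fun j _ => mul_div_assoc _ _ _
    · rw [div_div, ← sq, ← div_eq_mul_one_div]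
  have hanti : Antitone fun n => Y (n + k₀) := by
    refine antitone_nat_of_succ_le fun n => ?_
    have h1 := hYstep (n + k₀) (by omega)
    have h2 := mul_nonneg ha.le (hT0 (n + k₀ + 1))
    rw [add_right_comm n 1 k₀]
    linarith
  have hbdd : BddBelow (Set.range fun n => Y (n + k₀)) :=
    ⟨0, by rintro _ ⟨n, rfl⟩; exact hY0 _ (by omega)⟩
  obtain ⟨l, hl⟩ : ∃ l, Tendsto Y atTop (𝓝 l) :=
    ⟨_, (tendsto_add_atTop_iff_nat k₀).1 (tendsto_atTop_ciInf hanti hbdd)⟩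
  have hVl : Tendsto V atTop (𝓝 l) := by
    have hrem : Tendsto (fun k : ℕ => (G k + (B + b)) / k) atTop (𝓝 0) := by
      refine squeeze_zero_norm' (a := fun k : ℕ => (2 * B + b) / (k : ℝ)) ?_
        (tendsto_const_div_atTop_nhds_zero_nat _)
      filter_upwards [eventually_ge_atTop k₀] with k hk
      rw [norm_div, Real.norm_natCast, Real.norm_eq_abs]
      refine div_le_div_of_nonneg_right ?_ (Nat.cast_nonneg _)
      have := abs_le.1 (hG k hk)
      rw [abs_le]
      constructor <;> linarith
    have := hl.sub hrem
    simpa [hY] using this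
  have hl0 : 0 ≤ l := ge_of_tendsto' hVl hV
  rcases hl0.eq_or_lt with h0 | hpos
  · rwa [← h0] at hVl
  exfalso
  -- A positive limit l would give V ≥ l/2 eventually, and ∑ V_k/k would dominate a multiple of the
  -- harmonic series.
  obtain ⟨n, hn⟩ := (hVl.eventually (eventually_ge_nhds (half_lt_self hpos))).exists_forall_of_atTop
  refine Real.not_summable_one_div_natCast ?_
  have h1 : Summable fun k : ℕ => (2 / l) * (V k / k) := hsumV.mul_left _
  rw [← summable_nat_add_iff n] at h1 ⊢
  refine Summable.of_nonneg_of_le (fun k => by positivity) (fun k => ?_) h1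
  have h2 := hn (k + n) (by omega)
  rw [mul_div_assoc']
  refine div_le_div_of_nonneg_right ?_ (Nat.cast_nonneg _)
  rw [div_mul_eq_mul_div, le_div_iff₀ hpos]
  linarith

end RealSequences

/-! ### Projection onto a convex set. -/

section Projection

variable {p q : ℕ} {Θ : Set (Param p q)}

lemma IsProj.inner_sub_nonpos (hΘ : Convex ℝ Θ) {x v : Param p q} (hv : IsProj Θ x v)
    {w : Param p q} (hw : w ∈ Θ) : inner ℝ (x - v) (w - v) ≤ 0 := by
  have : Nonempty Θ := ⟨⟨v, hv.1⟩⟩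
  refine (norm_eq_iInf_iff_real_inner_le_zero hΘ hv.1).1 (le_antisymm ?_ ?_) w hw
  · exact le_ciInf fun w => hv.2 w w.2
  · exact ciInf_le ⟨0, by rintro _ ⟨w, rfl⟩; exact norm_nonneg _⟩ (⟨v, hv.1⟩ : Θ)

lemma IsProj.norm_sub_sq_le (hΘ : Convex ℝ Θ) {x v : Param p q} (hv : IsProj Θ x v)
    {w : Param p q} (hw : w ∈ Θ) : ‖v - w‖ ^ 2 ≤ ‖x - w‖ ^ 2 := by
  have h1 := hv.inner_sub_nonpos hΘ hw
  have h2 : ‖x - w‖ ^ 2 = ‖x - v‖ ^ 2 - 2 * inner ℝ (x - v) (w - v) + ‖w - v‖ ^ 2 := by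
    rw [← norm_sub_sq_real]; congr 2; abel
  rw [norm_sub_rev v w]
  nlinarith [sq_nonneg ‖x - v‖]

/-- Uniqueness is what makes the estimates functions of the data, since `IsProj` is only a relation.
-/
lemma IsProj.unique (hΘ : Convex ℝ Θ) {x v w : Param p q} (hv : IsProj Θ x v)
    (hw : IsProj Θ x w) : v = w := by
  have h1 := hv.inner_sub_nonpos hΘ hw.1
  have h2 := hw.inner_sub_nonpos hΘ hv.1
  have h3 : inner ℝ (w - v) (w - v) = inner ℝ (x - v) (w - v) + inner ℝ (x - w) (v - w) := by
    rw [← neg_sub w v, inner_neg_right, ← sub_eq_add_neg, ← inner_sub_left]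
    congr 1
    abel
  rw [real_inner_self_eq_norm_sq] at h3
  have h4 : ‖w - v‖ = 0 := by nlinarith [sq_nonneg ‖w - v‖]
  exact (sub_eq_zero.1 (norm_eq_zero.1 h4)).symm

lemma norm_le_radius (hΘ : IsCompact Θ) {v : Param p q} (hv : v ∈ Θ) : ‖v‖ ≤ radius Θ :=
  le_csSup (hΘ.image continuous_norm).bddAbove ⟨v, hv, rfl⟩

end Projection

/-! ### Functions of finitely many binary observations. -/

section PastDetermined

variable {Ω : Type*} {d : ℕ → Ω → ℝ} {C : ℝ} {y : ℤ → ℝ} {n : ℕ}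

/-- The random element `X` is a function of the binary observations up to time `n`. -/
def PastDetermined {E : Type*} (C : ℝ) (y : ℤ → ℝ) (d : ℕ → Ω → ℝ) (n : ℕ) (X : Ω → E) : Prop :=
  ∀ ω ω', (∀ i : ℕ, 1 ≤ i → i ≤ n →
    binaryObs C (y i + d i ω) = binaryObs C (y i + d i ω')) → X ω = X ω'

lemma PastDetermined.comp {E E' : Type*} {X : Ω → E} (hX : PastDetermined C y d n X)
    (g : E → E') : PastDetermined C y d n fun ω => g (X ω) :=
  fun ω ω' h => congrArg g (hX ω ω' h)

lemma PastDetermined.comp₂ {E E' E'' : Type*} {X : Ω → E} {Y : Ω → E'}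
    (hX : PastDetermined C y d n X) (hY : PastDetermined C y d n Y) (g : E → E' → E'') :
    PastDetermined C y d n fun ω => g (X ω) (Y ω) :=
  fun ω ω' h => congrArg₂ g (hX ω ω' h) (hY ω ω' h)

lemma PastDetermined.mono {E : Type*} {X : Ω → E} {k : ℕ} (hX : PastDetermined C y d n X)
    (hk : n ≤ k) : PastDetermined C y d k X :=
  fun ω ω' h => hX ω ω' fun i h1 h2 => h i h1 (h2.trans hk)

lemma binaryObs_eq_iff {C a b : ℝ} : binaryObs C a = binaryObs C b ↔ (a ≤ C ↔ b ≤ C) := by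
  unfold binaryObs
  split_ifs with h1 h2 h2 <;> simp [h1, h2]

lemma measurable_binaryObs_add (C a : ℝ) : Measurable fun x : ℝ => binaryObs C (a + x) :=
  Measurable.ite (measurableSet_le (by fun_prop) (by fun_prop)) measurable_const measurable_const

/-- The binary observations up to time `n` as a function of the noise. -/
noncomputable def bits (C : ℝ) (y : ℤ → ℝ) (n : ℕ) (x : Finset.range n → ℝ) :
    Finset.range n → Bool :=
  fun i => decide (y ((i : ℕ) + 1 : ℕ) + x i ≤ C)

lemma measurable_bits (C : ℝ) (y : ℤ → ℝ) (n : ℕ) : Measurable (bits C y n) := by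
  refine measurable_pi_lambda _ fun i => measurable_to_bool ?_
  have : (fun x : Finset.range n → ℝ => bits C y n x i) ⁻¹' {true} =
      {x | y ((i : ℕ) + 1 : ℕ) + x i ≤ C} := by
    ext x; simp [bits]
  rw [this]
  exact measurableSet_le (by fun_prop) (by fun_prop)

/-- Factoring through the finite set of bit strings makes every such real variable measurable and
bounded, with no regularity needed for the projection. -/
lemma PastDetermined.exists_eq {E : Type*} [Nonempty E] {X : Ω → E}
    (hX : PastDetermined C y d n X) :
    ∃ g : (Finset.range n → Bool) → E,
      X = fun ω => g (bits C y n fun i : Finset.range n => d ((i : ℕ) + 1) ω) := by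
  refine (Function.factorsThrough_iff (f := fun ω =>
    bits C y n fun i : Finset.range n => d ((i : ℕ) + 1) ω) X).1 fun ω ω' h => hX ω ω' ?_
  intro i h1 h2
  have := congrFun h ⟨i - 1, Finset.mem_range.2 (by omega)⟩
  obtain ⟨j, rfl⟩ : ∃ j, i = j + 1 := ⟨i - 1, by omega⟩
  rw [binaryObs_eq_iff]
  simpa [bits] using this

end PastDetermined

/-! ### The noise: density bounds and conditional mean of the observation. -/

section Noise

variable {Ω : Type*} [MeasurableSpace Ω] {μ : Measure Ω} {d : ℕ → Ω → ℝ} {F f : ℝ → ℝ}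

lemma IsNoise.monotone [IsFiniteMeasure μ] (hd : IsNoise μ d F f) : Monotone F := by
  intro a b hab
  rw [hd.cdf_eq 1 le_rfl, hd.cdf_eq 1 le_rfl]
  exact measureReal_mono fun ω (h : d 1 ω ≤ a) => h.trans hab

lemma IsNoise.density_nonneg [IsFiniteMeasure μ] (hd : IsNoise μ d F f) (x : ℝ) : 0 ≤ f x :=
  (hd.hasDerivAt x).nonneg_of_monotone hd.monotone

lemma IsNoise.mem_Icc [IsProbabilityMeasure μ] (hd : IsNoise μ d F f) (x : ℝ) :
    0 ≤ F x ∧ F x ≤ 1 := by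
  rw [hd.cdf_eq 1 le_rfl]
  exact ⟨measureReal_nonneg, measureReal_le_one⟩

lemma exists_mem_segment_sub_eq {F f : ℝ → ℝ} (hF : ∀ x, HasDerivAt F (f x) x) (a b : ℝ) :
    ∃ c ∈ Set.uIcc a b, F a - F b = f c * (a - b) := by
  rcases lt_trichotomy a b with hab | rfl | hab
  · obtain ⟨c, hc, h⟩ := exists_hasDerivAt_eq_slope F f hab
      (fun x _ => (hF x).continuousAt.continuousWithinAt) (fun x _ => hF x)
    refine ⟨c, Set.Icc_subset_uIcc (Set.Ioo_subset_Icc_self hc), ?_⟩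
    rw [h]
    field_simp [(sub_pos.2 hab).ne']
    ring
  · exact ⟨a, Set.left_mem_uIcc, by simp⟩
  · obtain ⟨c, hc, h⟩ := exists_hasDerivAt_eq_slope F f hab
      (fun x _ => (hF x).continuousAt.continuousWithinAt) (fun x _ => hF x)
    refine ⟨c, Set.Icc_subset_uIcc' (Set.Ioo_subset_Icc_self hc), ?_⟩
    rw [h]
    field_simp [(sub_pos.2 hab).ne']

/-- The pairing of the innovation `F(C - x) - F(C - y)` with `z` is bounded above through the
extreme values of the density. -/
lemma mul_sub_le_of_density_bounds {C R M₁ M₂ fm fM x y z : ℝ} (hF : ∀ x, HasDerivAt F (f x) x)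
    (hf : ∀ x, 0 ≤ f x) (hfM : IsGreatest (f '' densityRange C R M₁ M₂) fM)
    (hfm : IsLeast (f '' densityRange C R M₁ M₂) fm) (hx : |x| ≤ R * M₂) (hy : |y| ≤ R * M₁) :
    z * (F (C - x) - F (C - y)) ≤ -fm * z ^ 2 + fM * (|z| * |x - y - z|) := by
  obtain ⟨c, hc, h⟩ := exists_mem_segment_sub_eq hF (C - x) (C - y)
  -- Both intervals are centred at C, so the larger one contains both endpoints and the point
  -- between them.
  have hmem : c ∈ densityRange C R M₁ M₂ := by
    rw [abs_le] at hx hy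
    rw [Set.mem_uIcc] at hc
    rcases le_total (R * M₁) (R * M₂) with h12 | h12
    · refine Or.inl ⟨?_, ?_⟩ <;> rcases hc with hc | hc <;> linarith [hc.1, hc.2]
    · refine Or.inr ⟨?_, ?_⟩ <;> rcases hc with hc | hc <;> linarith [hc.1, hc.2]
  have h1 : fm ≤ f c := hfm.2 ⟨c, hmem, rfl⟩
  have h2 : f c ≤ fM := hfM.2 ⟨c, hmem, rfl⟩
  rw [h]
  have h3 : z * (f c * (C - x - (C - y))) = -(f c * z ^ 2) - f c * (z * (x - y - z)) := by ring
  have h4 : -(z * (x - y - z)) ≤ |z| * |x - y - z| := by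
    rw [← abs_mul]; exact neg_le_abs _
  have h5 : f c * -(z * (x - y - z)) ≤ fM * (|z| * |x - y - z|) :=
    (mul_le_mul_of_nonneg_left h4 (hf c)).trans
      (mul_le_mul_of_nonneg_right h2 (by positivity))
  have h6 := mul_le_mul_of_nonneg_right h1 (sq_nonneg z)
  linarith

variable {C : ℝ} {y : ℤ → ℝ} {n : ℕ}

lemma measurable_noise_tuple (hd : IsNoise μ d F f) (n : ℕ) :
    Measurable fun (ω : Ω) (i : Finset.range n) => d ((i : ℕ) + 1) ω :=
  measurable_pi_lambda _ fun _ => hd.measurable _ (Nat.le_add_left _ _)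

lemma PastDetermined.integrable [IsFiniteMeasure μ] (hd : IsNoise μ d F f) {X : Ω → ℝ}
    (hX : PastDetermined C y d n X) : Integrable X μ := by
  obtain ⟨g, rfl⟩ := hX.exists_eq
  refine Integrable.of_bound (C := ∑ b, |g b|) ?_ (ae_of_all _ fun ω => ?_)
  · exact ((measurable_of_finite g).comp
      ((measurable_bits C y n).comp (measurable_noise_tuple hd n))).aestronglyMeasurable
  · exact Finset.single_le_sum (f := fun b => |g b|) (fun _ _ => abs_nonneg _)
      (Finset.mem_univ _)

lemma integral_binaryObs (hd : IsNoise μ d F f) (C a : ℝ) {k : ℕ} (hk : 1 ≤ k) :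
    ∫ ω, binaryObs C (a + d k ω) ∂μ = F (C - a) := by
  have h1 : (fun ω => binaryObs C (a + d k ω)) =
      {ω | d k ω ≤ C - a}.indicator 1 := by
    funext ω
    simp only [binaryObs, Set.indicator, Set.mem_ofPred_eq, le_sub_iff_add_le', Pi.one_apply]
  rw [h1, integral_indicator_one (measurableSet_le (hd.measurable k hk) measurable_const),
    hd.cdf_eq k hk]

/-- This is the martingale property: X depends on d₁, …, d_n only and is therefore independent of
d_{n+1}. -/
lemma PastDetermined.integral_mul_binaryObs [IsFiniteMeasure μ] (hd : IsNoise μ d F f)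
    {X : Ω → ℝ} (hX : PastDetermined C y d n X) (a : ℝ) :
    ∫ ω, X ω * binaryObs C (a + d (n + 1) ω) ∂μ = (∫ ω, X ω ∂μ) * F (C - a) := by
  have hint := hX.integrable hd
  obtain ⟨g, hg⟩ := hX.exists_eq
  have hindep := hd.indep.indepFun_finset (Finset.range n) {n} (by simp)
    (fun i => hd.measurable _ (Nat.le_add_left _ _))
  have hψ : Measurable fun x : ({n} : Finset ℕ) → ℝ =>
      binaryObs C (a + x ⟨n, Finset.mem_singleton_self n⟩) :=
    (measurable_binaryObs_add C a).comp (measurable_pi_apply _)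
  have h2 := hindep.comp ((measurable_of_finite g).comp (measurable_bits C y n)) hψ
  have h3 : IndepFun X (fun ω => binaryObs C (a + d (n + 1) ω)) μ := by
    rw [hg]; exact h2
  rw [h3.integral_fun_mul_eq_mul_integral hint.aestronglyMeasurable
    ((measurable_binaryObs_add C a).comp
      (hd.measurable _ (Nat.le_add_left _ _))).aestronglyMeasurable,
    integral_binaryObs hd C a (Nat.le_add_left _ _)]

end Noise

/-! ### The algorithm is driven by past observations only. -/

section Trajectory

variable {p q : ℕ} {Ω : Type*} {Θ : Set (Param p q)} {C γ : ℝ} {F : ℝ → ℝ}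
  {u y : ℤ → ℝ} {d : ℕ → Ω → ℝ} {θhat : ℕ → Ω → Param p q} {yhat : ℤ → Ω → ℝ}

lemma regressor_congr {y y' u : ℤ → ℝ} {k : ℤ} (h : ∀ i < k, y i = y' i) :
    regressor p q y u k = regressor p q y' u k := by
  unfold regressor
  congr 2
  funext j
  exact h _ (by omega)

/-- Joint induction: the regressor at n + 1 involves predictions up to time n only, so the new bit
enters solely through the update of the estimate. -/
lemma pastDetermined_trajectory (hΘ : Convex ℝ Θ) {θ₀ : Param p q} (hθ₀ : ∀ ω, θhat 0 ω = θ₀)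
    {y₀ : ℤ → ℝ} (hy₀ : ∀ k : ℤ, k ≤ 0 → ∀ ω, yhat k ω = y₀ k)
    (halg : ∀ ω, IsTrajectory Θ γ C F u (fun k => binaryObs C (y k + d k ω))
      (fun k => θhat k ω) (fun k => yhat k ω)) (n : ℕ) :
    PastDetermined C y d n (θhat n) ∧ ∀ k : ℤ, k ≤ n → PastDetermined C y d n (yhat k) := by
  induction n with
  | zero =>
    exact ⟨fun ω ω' _ => by rw [hθ₀, hθ₀], fun k hk ω ω' _ => by
      rw [hy₀ k (by simpa using hk), hy₀ k (by simpa using hk)]⟩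
  | succ n ih =>
    have hstep : ∀ ω ω', (∀ i : ℕ, 1 ≤ i → i ≤ n + 1 →
        binaryObs C (y i + d i ω) = binaryObs C (y i + d i ω')) →
        regressor p q (fun i => yhat i ω) u ((n + 1 : ℕ) : ℤ) =
          regressor p q (fun i => yhat i ω') u ((n + 1 : ℕ) : ℤ) ∧
        θhat (n + 1) ω = θhat (n + 1) ω' := by
      intro ω ω' h
      have h' : ∀ i : ℕ, 1 ≤ i → i ≤ n →
        binaryObs C (y i + d i ω) = binaryObs C (y i + d i ω') := fun i h1 h2 => h i h1 (by omega)
      have hr : regressor p q (fun i => yhat i ω) u ((n + 1 : ℕ) : ℤ) =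
          regressor p q (fun i => yhat i ω') u ((n + 1 : ℕ) : ℤ) :=
        regressor_congr fun i hi => ih.2 i (by push_cast at hi; omega) ω ω' h'
      refine ⟨hr, ?_⟩
      have e1 := (halg ω).estimate (n + 1) (by omega)
      have e2 := (halg ω').estimate (n + 1) (by omega)
      simp only [Nat.add_sub_cancel] at e1 e2
      rw [hr, ih.1 ω ω' h', h (n + 1) (by omega) le_rfl] at e1
      exact e1.unique hΘ e2
    refine ⟨fun ω ω' h => (hstep ω ω' h).2, fun k hk ω ω' h => ?_⟩
    rcases eq_or_lt_of_le hk with rfl | hlt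
    · rw [(halg ω).predict (n + 1) (by omega), (halg ω').predict (n + 1) (by omega),
        (hstep ω ω' h).1, (hstep ω ω' h).2]
    · exact ((ih.2 k (by push_cast at hlt; omega)).mono (Nat.le_succ n)) ω ω' h

end Trajectory

/-! ### From the numerical hypothesis to the small gain condition. -/

section Gain

variable {p q : ℕ}

/-- The `ℓ²` gain of the map `η ↦ ∑ a_j η_{k-j}` is at most `√p ‖a‖`. -/
noncomputable def arGain (θ : Param p q) : ℝ :=
  Real.sqrt p * Real.sqrt (∑ j : Fin p, θ (Sum.inl j) ^ 2)

lemma arGain_sq (θ : Param p q) :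
    arGain θ ^ 2 = p * ∑ j : Fin p, θ (Sum.inl j) ^ 2 := by
  rw [arGain, mul_pow, Real.sq_sqrt (Nat.cast_nonneg _),
    Real.sq_sqrt (Finset.sum_nonneg fun _ _ => sq_nonneg _)]

lemma arGain_pos {θ : Param p q} {j : Fin p} (hj : θ (Sum.inl j) ≠ 0) : 0 < arGain θ := by
  have hp : 0 < p := j.pos
  refine mul_pos (Real.sqrt_pos.2 (by exact_mod_cast hp)) (Real.sqrt_pos.2 ?_)
  exact Finset.sum_pos' (fun _ _ => sq_nonneg _) ⟨j, Finset.mem_univ _, by positivity⟩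

lemma arGain_le {θ : Param p q} {h : ℝ} (hh : 0 < h) (hθ : θ ∈ causalSet p q h) :
    arGain θ ≤ Real.sqrt p * Real.sqrt (gBound p h) :=
  mul_le_mul_of_nonneg_left (Real.sqrt_le_sqrt (sum_sq_coeff_le_gBound hh hθ)) (Real.sqrt_nonneg _)

/-- For p = 1 the gain is |a₁|, at most the spectral radius. For p ≥ 2 the power is at least 1/ε, so
the gain is at most ε ≤ ε‖A‖ ≤ h₁. -/
lemma arGain_le_of_mul_le {θ : Param p q} {h ε h₁ : ℝ} (hp : 0 < p) (hh : 0 < h)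
    (hθ : θ ∈ causalSet p q h) (hε : 0 < ε)
    (hh₁ : specRad (companion θ) + ε * opNorm (companion θ) ≤ h₁)
    (hsmall : arGain θ * (1 + 2 / ε) ^ (p - 1) ≤ 1) : arGain θ ≤ h₁ := by
  have hop : 0 ≤ opNorm (companion θ) := norm_nonneg _
  have hsp := specRad_nonneg (companion θ)
  rcases (Nat.succ_le_of_lt hp).eq_or_lt with h1 | h2
  · obtain rfl : p = 1 := h1.symm
    have h2 := abs_le_specRad_companion_one hh hθ
    have h3 : arGain θ = |θ (Sum.inl 0)| := by simp [arGain, Real.sqrt_sq_eq_abs]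
    rw [h3]
    nlinarith
  · have h3 : ε ≤ ε * opNorm (companion θ) :=
      le_mul_of_one_le_right hε.le (one_le_opNorm_companion θ h2)
    have hs : 0 ≤ arGain θ := mul_nonneg (Real.sqrt_nonneg _) (Real.sqrt_nonneg _)
    have h4 : 1 + 2 / ε ≤ (1 + 2 / ε) ^ (p - 1) :=
      le_self_pow₀ (by have : 0 < 2 / ε := by positivity
                       linarith) (by omega)
    have h5 : arGain θ * (1 / ε) ≤ 1 := by
      refine le_trans (mul_le_mul_of_nonneg_left (le_trans ?_ h4) hs) hsmall
      rw [show (2 : ℝ) / ε = 1 / ε + 1 / ε by ring]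
      have : 0 < 1 / ε := by positivity
      linarith
    rw [mul_one_div, div_le_one hε] at h5
    linarith

/-- Since δ ≤ M₂² ≤ M₂(M₂ + 2M₁), the hypothesis gives fM κ < fm, and fm ≤ fM gives κ < 1. The
latter forces s ≤ h₁, so 1 - h₁ ≤ 1 - s and s/(1 - s) ≤ κ. -/
lemma arGain_small {θ : Param p q} {h ε h₁ M₁ M₂ δ fm fM : ℝ} (hp : 0 < p) (hh : 0 < h)
    (hθ : θ ∈ causalSet p q h) (hε : 0 < ε)
    (hh₁ : specRad (companion θ) + ε * opNorm (companion θ) ≤ h₁) (hh₁1 : h₁ < 1)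
    (hM₁ : 0 < M₁) (hM₂ : 0 < M₂) (hδ : 0 < δ) (hδM : δ ≤ M₂ ^ 2) (hfM : 0 ≤ fM) (hf : fm ≤ fM)
    (hcond : 0 < fm * δ -
      fM * Real.sqrt (gBound p h) * M₂ * powerConst p ε / (1 - h₁) * (M₂ + 2 * M₁)) :
    arGain θ < 1 ∧ fM * (arGain θ / (1 - arGain θ)) < fm := by
  set S := Real.sqrt (gBound p h)
  set κ := Real.sqrt p * S * (1 + 2 / ε) ^ (p - 1) / (1 - h₁) with hκ
  have hh₁' : 0 < 1 - h₁ := by linarith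
  have hκ0 : 0 ≤ κ := by positivity
  have h1 : fM * κ < fm := by
    have e : fM * S * M₂ * powerConst p ε / (1 - h₁) * (M₂ + 2 * M₁) =
        fM * κ * (M₂ * (M₂ + 2 * M₁)) := by
      rw [powerConst, hκ]; ring
    rw [e] at hcond
    have h2 : δ ≤ M₂ * (M₂ + 2 * M₁) := by nlinarith [mul_pos hM₁ hM₂]
    have h3 := mul_le_mul_of_nonneg_left h2 (mul_nonneg hfM hκ0)
    exact lt_of_mul_lt_mul_right (by linarith) hδ.le
  have hfM0 : 0 < fM := by nlinarith [mul_nonneg hfM hκ0]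
  have hκ1 : κ < 1 := by
    by_contra! hge
    nlinarith
  have hnum : Real.sqrt p * S * (1 + 2 / ε) ^ (p - 1) < 1 - h₁ := by
    rwa [hκ, div_lt_one hh₁'] at hκ1
  have hle := arGain_le hh hθ
  have hpow0 : 0 ≤ (1 + 2 / ε) ^ (p - 1) := by positivity
  have hpow1 : 1 ≤ (1 + 2 / ε) ^ (p - 1) :=
    one_le_pow₀ (by have : 0 < 2 / ε := by positivity
                    linarith)
  have hop : 0 ≤ opNorm (companion θ) := norm_nonneg _
  have hh₁0 : 0 ≤ h₁ := by nlinarith [specRad_nonneg (companion θ)]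
  have hs : arGain θ ≤ h₁ := arGain_le_of_mul_le hp hh hθ hε hh₁
    (by have := mul_le_mul_of_nonneg_right hle hpow0
        linarith)
  refine ⟨by linarith, lt_of_le_of_lt (mul_le_mul_of_nonneg_left ?_ hfM) h1⟩
  rw [hκ]
  refine div_le_div₀ (by positivity) ?_ hh₁' (by linarith)
  exact hle.trans (le_mul_of_one_le_right (by positivity) hpow1)

/-- Excitation is tested on the b₁ coordinate, where the regressor is the current input whatever the
output sequence is; the bound for `y'` therefore applies. -/
lemma le_sq_of_excites {y y' u : ℤ → ℝ} {N : ℕ} {δ M₂ : ℝ} (hq : 0 < q) (hN : 0 < N)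
    (hexc : Excites (regressor p q y u) N δ)
    (hM₂ : ∀ k : ℤ, 1 ≤ k → ‖regressor p q y' u k‖ ≤ M₂) : δ ≤ M₂ ^ 2 := by
  have h1 := hexc 1 le_rfl (EuclideanSpace.single (Sum.inr ⟨0, hq⟩) 1)
  have hN' : (0 : ℝ) < N := by exact_mod_cast hN
  rw [PiLp.norm_single, norm_one, one_pow, mul_one] at h1
  refine h1.trans ?_
  rw [one_div, inv_mul_le_iff₀ hN']
  calc _ ≤ ∑ _i ∈ Finset.range N, M₂ ^ 2 := by
        refine Finset.sum_le_sum fun i _ => ?_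
        have h2 := hM₂ (1 + (i : ℤ)) (by omega)
        have h3 :=
          (PiLp.norm_apply_le (regressor p q y' u (1 + (i : ℤ))) (Sum.inr ⟨0, hq⟩)).trans h2
        rw [Real.norm_eq_abs] at h3
        have h4 := abs_le.1 h3
        rw [EuclideanSpace.inner_single_right]
        refine sq_le_sq' ?_ ?_ <;> simpa [regressor] using by first | exact h4.1 | exact h4.2
    _ = _ := by simp

end Gain

/-! ### Pathwise estimates along one trajectory. -/

section Pathwise

variable {p q : ℕ} {Θ : Set (Param p q)} {θ : Param p q} {C γ M₁ M₂ : ℝ} {F f : ℝ → ℝ}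
  {u y yh : ℤ → ℝ} {s : ℕ → ℝ} {th : ℕ → Param p q}

lemma norm_smul_regressor_le (hM₂ : ∀ k : ℤ, 1 ≤ k → ‖regressor p q yh u k‖ ≤ M₂) (hγ : 0 < γ)
    (hs : ∀ k, 0 ≤ s k ∧ s k ≤ 1) (hF : ∀ x, 0 ≤ F x ∧ F x ≤ 1) (k : ℕ) (x : ℝ) :
    ‖((γ / ((k : ℝ) + 1)) * (F x - s (k + 1))) • regressor p q yh u ((k + 1 : ℕ) : ℤ)‖ ≤
      γ * M₂ / ((k : ℝ) + 1) := by
  have h1 := hM₂ ((k + 1 : ℕ) : ℤ) (by omega)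
  have h2 : |F x - s (k + 1)| ≤ 1 := by
    have := hF x
    have := hs (k + 1)
    rw [abs_le]
    constructor <;> linarith
  have h0 : 0 ≤ γ / ((k : ℝ) + 1) := by positivity
  rw [norm_smul, norm_mul, Real.norm_eq_abs, Real.norm_eq_abs, abs_of_nonneg h0]
  calc _ ≤ γ / ((k : ℝ) + 1) * 1 * M₂ := by gcongr
    _ = _ := by ring

lemma IsTrajectory.isProj_succ (hT : IsTrajectory Θ γ C F u s th yh) (k : ℕ) :
    IsProj Θ (th k + ((γ / ((k : ℝ) + 1)) *
      (F (C - inner ℝ (regressor p q yh u ((k + 1 : ℕ) : ℤ)) (th k)) - s (k + 1))) •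
        regressor p q yh u ((k + 1 : ℕ) : ℤ)) (th (k + 1)) := by
  have := hT.estimate (k + 1) (by omega)
  simpa only [Nat.add_sub_cancel, Nat.cast_add, Nat.cast_one] using this

lemma IsTrajectory.mem (hT : IsTrajectory Θ γ C F u s th yh) {k : ℕ} (hk : 1 ≤ k) : th k ∈ Θ :=
  (hT.estimate k hk).1

lemma IsTrajectory.norm_sub_sq_le (hT : IsTrajectory Θ γ C F u s th yh) (hΘ : Convex ℝ Θ)
    (hθ : θ ∈ Θ) (hM₂ : ∀ k : ℤ, 1 ≤ k → ‖regressor p q yh u k‖ ≤ M₂) (hγ : 0 < γ)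
    (hs : ∀ k, 0 ≤ s k ∧ s k ≤ 1) (hF : ∀ x, 0 ≤ F x ∧ F x ≤ 1) (k : ℕ) :
    ‖th (k + 1) - θ‖ ^ 2 ≤ ‖th k - θ‖ ^ 2 + 2 * γ / ((k : ℝ) + 1) *
      (inner ℝ (regressor p q yh u ((k + 1 : ℕ) : ℤ)) (th k - θ) *
        (F (C - inner ℝ (regressor p q yh u ((k + 1 : ℕ) : ℤ)) (th k)) - s (k + 1))) +
      (γ * M₂ / ((k : ℝ) + 1)) ^ 2 := by
  refine ((hT.isProj_succ k).norm_sub_sq_le hΘ hθ).trans ?_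
  set ψ := regressor p q yh u ((k + 1 : ℕ) : ℤ)
  rw [add_sub_right_comm, norm_add_sq_real, inner_smul_right, real_inner_comm ψ (th k - θ)]
  have h1 := pow_le_pow_left₀ (norm_nonneg _) (norm_smul_regressor_le hM₂ hγ hs hF k
    (C - inner ℝ ψ (th k))) 2
  have e : ∀ a b : ℝ, 2 * (γ / ((k : ℝ) + 1) * a * b) = 2 * γ / ((k : ℝ) + 1) * (b * a) := by
    intro a b; ring
  rw [e]
  linarith

/-- The projection contracts distances to θ̂_k itself. This needs θ̂_k ∈ Θ, hence k ≥ 1: the initial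
value may lie outside Θ. -/
lemma IsTrajectory.norm_sub_succ_le (hT : IsTrajectory Θ γ C F u s th yh) (hΘ : Convex ℝ Θ)
    (hM₂ : ∀ k : ℤ, 1 ≤ k → ‖regressor p q yh u k‖ ≤ M₂) (hγ : 0 < γ)
    (hs : ∀ k, 0 ≤ s k ∧ s k ≤ 1) (hF : ∀ x, 0 ≤ F x ∧ F x ≤ 1) {k : ℕ} (hk : 1 ≤ k) :
    ‖th (k + 1) - th k‖ ≤ γ * M₂ / ((k : ℝ) + 1) := by
  have h1 := (hT.isProj_succ k).norm_sub_sq_le hΘ (hT.mem hk)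
  rw [add_sub_cancel_left] at h1
  exact (abs_le_of_sq_le_sq' h1 (norm_nonneg _)).2.trans
    (norm_smul_regressor_le hM₂ hγ hs hF k _)

lemma IsTrajectory.norm_sub_add_le (hT : IsTrajectory Θ γ C F u s th yh) (hΘ : Convex ℝ Θ)
    (hM₂ : ∀ k : ℤ, 1 ≤ k → ‖regressor p q yh u k‖ ≤ M₂) (hγ : 0 < γ)
    (hs : ∀ k, 0 ≤ s k ∧ s k ≤ 1) (hF : ∀ x, 0 ≤ F x ∧ F x ≤ 1) {k : ℕ} (hk : 1 ≤ k) (i : ℕ) :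
    ‖th (k + i) - th k‖ ≤ i * (γ * M₂ / k) := by
  have hM0 : 0 ≤ M₂ := (norm_nonneg _).trans (hM₂ 1 le_rfl)
  have hk' : (0 : ℝ) < k := by exact_mod_cast hk
  induction i with
  | zero => simp
  | succ i ih =>
    have h1 := hT.norm_sub_succ_le hΘ hM₂ hγ hs hF (k := k + i) (by omega)
    have h2 : γ * M₂ / (((k + i : ℕ) : ℝ) + 1) ≤ γ * M₂ / k := by
      refine div_le_div_of_nonneg_left (by positivity) hk' ?_
      push_cast
      have : (0 : ℝ) ≤ i := Nat.cast_nonneg i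
      linarith
    have h3 := norm_sub_le_norm_sub_add_norm_sub (th (k + i + 1)) (th (k + i)) (th k)
    rw [← add_assoc]
    push_cast
    linarith

lemma inner_regressor_sub (y y' u : ℤ → ℝ) (k : ℤ) (x : Param p q) :
    inner ℝ (regressor p q y u k) x - inner ℝ (regressor p q y' u k) x =
      ∑ j : Fin p, x (Sum.inl j) * (y (k - 1 - (j : ℕ)) - y' (k - 1 - (j : ℕ))) := by
  rw [inner_regressor, inner_regressor, add_sub_add_right_eq_sub, ← Finset.sum_sub_distrib]
  exact Finset.sum_congr rfl fun j _ => by ring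

lemma sq_inner_regressor_sub_le (y y' u : ℤ → ℝ) (k : ℤ) (x : Param p q) :
    (inner ℝ (regressor p q y u k) x - inner ℝ (regressor p q y' u k) x) ^ 2 ≤
      (∑ j : Fin p, x (Sum.inl j) ^ 2) *
        ∑ j ∈ Finset.range p, (y (k - 1 - (j : ℕ)) - y' (k - 1 - (j : ℕ))) ^ 2 := by
  rw [inner_regressor_sub, Finset.sum_range]
  exact Finset.sum_mul_sq_le_sq_mul_sq _ _ _

lemma sum_sq_inl_le (x : Param p q) : ∑ j : Fin p, x (Sum.inl j) ^ 2 ≤ ‖x‖ ^ 2 := by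
  rw [EuclideanSpace.norm_sq_eq, Fintype.sum_sum_type]
  simp only [Real.norm_eq_abs, sq_abs]
  exact le_add_of_nonneg_right (Finset.sum_nonneg fun _ _ => sq_nonneg _)

lemma IsOutput.eq_inner (hy : IsOutput θ u y) {k : ℤ} (hk : 1 ≤ k) :
    y k = inner ℝ (regressor p q y u k) θ := by
  rw [hy k hk, inner_regressor]

lemma abs_le_of_norm_regressor_le (hp : 0 < p) {M : ℝ}
    (hM : ∀ k : ℤ, 1 ≤ k → ‖regressor p q y u k‖ ≤ M) {k : ℤ} (hk : 0 ≤ k) : |y k| ≤ M := by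
  have h := (PiLp.norm_apply_le (regressor p q y u (k + 1)) (Sum.inl ⟨0, hp⟩)).trans
    (hM (k + 1) (by omega))
  simpa [regressor] using h

/-- The storage function of the filter `η ↦ ∑ a_j η_{k-j}`. -/
noncomputable def storage (θ : Param p q) (η : ℤ → ℝ) (k : ℕ) : ℝ :=
  (∑ j : Fin p, θ (Sum.inl j) ^ 2) *
    ∑ j ∈ Finset.range p, ((p : ℝ) - j) * η ((k : ℤ) - (j : ℕ)) ^ 2

/-- By Cauchy–Schwarz the subtracted term dominates β², so β² ≤ s²η² - Δ with Δ the storage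
increment: the form required by the small gain estimate. -/
lemma storage_succ_sub (θ : Param p q) (η : ℤ → ℝ) (k : ℕ) :
    storage θ η (k + 1) - storage θ η k = arGain θ ^ 2 * η ((k + 1 : ℕ) : ℤ) ^ 2 -
      (∑ j : Fin p, θ (Sum.inl j) ^ 2) *
        ∑ j ∈ Finset.range p, η (((k + 1 : ℕ) : ℤ) - 1 - (j : ℕ)) ^ 2 := by
  have h := sum_storage_sub_sum_storage_shift p fun j => η (((k + 1 : ℕ) : ℤ) - (j : ℕ)) ^ 2
  have e : ∀ j : ℕ, ((k + 1 : ℕ) : ℤ) - ((j + 1 : ℕ) : ℤ) = (k : ℤ) - (j : ℕ) := by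
    intro j; push_cast; ring
  have e' : ∀ j : ℕ, ((k + 1 : ℕ) : ℤ) - 1 - (j : ℤ) = (k : ℤ) - (j : ℕ) := by
    intro j; push_cast; ring
  simp only [e, Nat.cast_zero, sub_zero] at h
  simp only [e']
  rw [storage, storage, ← mul_sub, h, arGain_sq]
  ring

lemma abs_storage_le (θ : Param p q) {η : ℤ → ℝ} {K : ℝ} (hη : ∀ k : ℤ, 0 ≤ k → |η k| ≤ K)
    {k : ℕ} (hk : p ≤ k) :
    |storage θ η k| ≤ (∑ j : Fin p, θ (Sum.inl j) ^ 2) * (p * (p * K ^ 2)) := by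
  have h0 : 0 ≤ ∑ j : Fin p, θ (Sum.inl j) ^ 2 := Finset.sum_nonneg fun _ _ => sq_nonneg _
  have hterm : ∀ j ∈ Finset.range p, 0 ≤ (p : ℝ) - j := by
    intro j hj
    exact sub_nonneg.2 (by exact_mod_cast (Finset.mem_range.1 hj).le)
  rw [storage, abs_mul, abs_of_nonneg h0, abs_of_nonneg
    (Finset.sum_nonneg fun j hj => mul_nonneg (hterm j hj) (sq_nonneg _))]
  refine mul_le_mul_of_nonneg_left ?_ h0
  calc _ ≤ ∑ _j ∈ Finset.range p, (p : ℝ) * K ^ 2 := by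
        refine Finset.sum_le_sum fun j hj => ?_
        have hjp := Finset.mem_range.1 hj
        have h1 := abs_le.1 (hη ((k : ℤ) - (j : ℕ)) (by omega))
        refine mul_le_mul ?_ (sq_le_sq' h1.1 h1.2) (sq_nonneg _) (Nat.cast_nonneg _)
        have : (0 : ℝ) ≤ j := Nat.cast_nonneg j
        linarith
    _ = _ := by simp

lemma IsTrajectory.lyapunov_step (hT : IsTrajectory Θ γ C F u s th yh) (hp : 0 < p)
    (hΘ : Convex ℝ Θ) (hΘc : IsCompact Θ)
    (hθ : θ ∈ Θ) (hM₂ : ∀ k : ℤ, 1 ≤ k → ‖regressor p q yh u k‖ ≤ M₂)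
    (hM₁ : ∀ k : ℤ, 1 ≤ k → ‖regressor p q y u k‖ ≤ M₁) (hy : IsOutput θ u y) (hγ : 0 < γ)
    (hs : ∀ k, 0 ≤ s k ∧ s k ≤ 1) (hF : ∀ x, 0 ≤ F x ∧ F x ≤ 1)
    (hFf : ∀ x, HasDerivAt F (f x) x) (hf : ∀ x, 0 ≤ f x) {fm fM c₁ c₂ c₃ : ℝ}
    (hfM : IsGreatest (f '' densityRange C (radius Θ) M₁ M₂) fM)
    (hfm : IsLeast (f '' densityRange C (radius Θ) M₁ M₂) fm)
    (hgain : ∀ z β η Δ ρ : ℝ, 0 ≤ ρ →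
      η ^ 2 ≤ (z + β) ^ 2 + ρ → β ^ 2 ≤ arGain θ ^ 2 * η ^ 2 - Δ →
      -fm * z ^ 2 + fM * (|z| * |β|) ≤ -c₁ * (z ^ 2 + η ^ 2) - c₂ * Δ + c₃ * ρ)
    {k : ℕ} (hk : 1 ≤ k) :
    ‖th (k + 1) - θ‖ ^ 2 ≤ ‖th k - θ‖ ^ 2 + (1 / ((k : ℝ) + 1)) *
        (-(2 * γ * c₁) * (inner ℝ (regressor p q yh u ((k + 1 : ℕ) : ℤ)) (th k - θ) ^ 2 +
            (yh ((k + 1 : ℕ) : ℤ) - y ((k + 1 : ℕ) : ℤ)) ^ 2) -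
          2 * γ * c₂ * (storage θ (fun i => yh i - y i) (k + 1) -
            storage θ (fun i => yh i - y i) k)) +
      (4 * γ ^ 2 * c₃ * (M₁ + M₂) * M₂ ^ 2 + γ ^ 2 * M₂ ^ 2) / ((k : ℝ) + 1) ^ 2 +
      2 * γ / ((k : ℝ) + 1) * (inner ℝ (regressor p q yh u ((k + 1 : ℕ) : ℤ)) (th k - θ) *
        (F (C - y ((k + 1 : ℕ) : ℤ)) - s (k + 1))) := by
  have hk1 : (1 : ℤ) ≤ ((k + 1 : ℕ) : ℤ) := by omega
  have h1 := hT.norm_sub_sq_le hΘ hθ hM₂ hγ hs hF k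
  have hpred := hT.predict (k + 1) (by omega)
  have hyk := hy.eq_inner hk1
  have hψ := hM₂ _ hk1
  have hφ := hM₁ _ hk1
  have hdiff := sq_inner_regressor_sub_le yh y u ((k + 1 : ℕ) : ℤ) θ
  have hηb : |yh ((k + 1 : ℕ) : ℤ) - y ((k + 1 : ℕ) : ℤ)| ≤ M₁ + M₂ := by
    have h2 := abs_le_of_norm_regressor_le hp hM₂ (k := ((k + 1 : ℕ) : ℤ)) (by omega)
    have h3 := abs_le_of_norm_regressor_le hp hM₁ (k := ((k + 1 : ℕ) : ℤ)) (by omega)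
    have := abs_sub (yh ((k + 1 : ℕ) : ℤ)) (y ((k + 1 : ℕ) : ℤ))
    linarith
  have hstor := storage_succ_sub θ (fun i => yh i - y i) k
  set Δ := storage θ (fun i => yh i - y i) (k + 1) - storage θ (fun i => yh i - y i) k
  set ψ := regressor p q yh u ((k + 1 : ℕ) : ℤ)
  set φ := regressor p q y u ((k + 1 : ℕ) : ℤ)
  set η := yh ((k + 1 : ℕ) : ℤ) - y ((k + 1 : ℕ) : ℤ) with hη
  set z : ℝ := inner ℝ ψ (th k - θ) with hz
  set β : ℝ := inner ℝ ψ θ - inner ℝ φ θ with hβ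
  have hM0 : 0 ≤ M₂ := (norm_nonneg _).trans hψ
  have hM0' : 0 ≤ M₁ := (norm_nonneg _).trans hφ
  -- The prediction ŷ_{k+1} uses the updated estimate, so η differs from z + β by ψᵀ(θ̂_{k+1} -
  -- θ̂_k), which is at most `r`.
  set r : ℝ := γ * M₂ ^ 2 / ((k : ℝ) + 1) with hr
  have hr0 : 0 ≤ r := by positivity
  have hclose : |η - (z + β)| ≤ r := by
    have e : η - (z + β) = inner ℝ ψ (th (k + 1) - th k) := by
      rw [hη, hpred, hyk, hz, hβ, inner_sub_right, inner_sub_right]; ring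
    rw [e]
    calc _ ≤ ‖ψ‖ * ‖th (k + 1) - th k‖ := abs_real_inner_le_norm _ _
      _ ≤ M₂ * (γ * M₂ / ((k : ℝ) + 1)) :=
        mul_le_mul hψ (hT.norm_sub_succ_le hΘ hM₂ hγ hs hF hk) (norm_nonneg _) hM0
      _ = r := by rw [hr]; ring
  have hsq : η ^ 2 ≤ (z + β) ^ 2 + 2 * (M₁ + M₂) * r := by
    have e : η ^ 2 = (z + β) ^ 2 + 2 * (η * (η - (z + β))) - (η - (z + β)) ^ 2 := by ring
    have h2 : η * (η - (z + β)) ≤ (M₁ + M₂) * r := by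
      refine (le_abs_self _).trans ?_
      rw [abs_mul]
      exact mul_le_mul hηb hclose (abs_nonneg _) (by positivity)
    nlinarith [sq_nonneg (η - (z + β))]
  have hβsq : β ^ 2 ≤ arGain θ ^ 2 * η ^ 2 - Δ := by linarith
  have hR : ∀ {v : Param p q} {w : Param p q} {M : ℝ}, v ∈ Θ → ‖w‖ ≤ M →
      |inner ℝ w v| ≤ radius Θ * M := by
    intro v w M hv hw
    rw [mul_comm]
    exact (abs_real_inner_le_norm _ _).trans
      (mul_le_mul hw (norm_le_radius hΘc hv) (norm_nonneg _) ((norm_nonneg _).trans hw))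
  have hdrift := mul_sub_le_of_density_bounds (z := z) hFf hf hfM hfm
    (hR (hT.mem hk) hψ) (hR hθ hφ)
  have e : inner ℝ ψ (th k) - inner ℝ φ θ - z = β := by
    rw [hz, hβ, inner_sub_right]; ring
  rw [e, ← hyk] at hdrift
  have h2 := hdrift.trans (hgain z β η Δ _ (by positivity) hsq hβsq)
  have h3 : 0 ≤ 2 * γ / ((k : ℝ) + 1) := by positivity
  have h4 := mul_le_mul_of_nonneg_left h2 h3
  have e5 : z * (F (C - inner ℝ ψ (th k)) - s (k + 1)) =
      z * (F (C - inner ℝ ψ (th k)) - F (C - y ((k + 1 : ℕ) : ℤ))) +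
        z * (F (C - y ((k + 1 : ℕ) : ℤ)) - s (k + 1)) := by ring
  rw [e5, mul_add] at h1
  refine h1.trans ?_
  have e6 : 2 * γ / ((k : ℝ) + 1) *
      (-c₁ * (z ^ 2 + η ^ 2) - c₂ * Δ + c₃ * (2 * (M₁ + M₂) * r)) +
      (γ * M₂ / ((k : ℝ) + 1)) ^ 2 =
      (1 / ((k : ℝ) + 1)) * (-(2 * γ * c₁) * (z ^ 2 + η ^ 2) - 2 * γ * c₂ * Δ) +
      (4 * γ ^ 2 * c₃ * (M₁ + M₂) * M₂ ^ 2 + γ ^ 2 * M₂ ^ 2) / ((k : ℝ) + 1) ^ 2 := by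
    rw [hr]
    field_simp
    ring
  linarith

/-- Excitation is applied to the frozen error θ̂_k - θ. Replacing φ by ψ costs past values of η, and
letting the estimate move costs O(1/k) per step; the three contributions are separated by (a - b -
c)² ≤ 3(a² + b² + c²). -/
lemma IsTrajectory.window_bound (hT : IsTrajectory Θ γ C F u s th yh)
    (hΘ : Convex ℝ Θ) (hΘc : IsCompact Θ)
    (hθ : θ ∈ Θ) (hM₂ : ∀ k : ℤ, 1 ≤ k → ‖regressor p q yh u k‖ ≤ M₂)
    (hM₁ : ∀ k : ℤ, 1 ≤ k → ‖regressor p q y u k‖ ≤ M₁) (hγ : 0 < γ)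
    (hs : ∀ k, 0 ≤ s k ∧ s k ≤ 1) (hF : ∀ x, 0 ≤ F x ∧ F x ≤ 1) {N : ℕ} {δ : ℝ}
    (hexc : Excites (regressor p q y u) N δ) {k : ℕ} (hk : 1 ≤ k) (hpk : p ≤ k) :
    δ * ‖th k - θ‖ ^ 2 ≤ (1 / (N : ℝ)) * ∑ i ∈ Finset.range N,
      (3 * inner ℝ (regressor p q yh u ((k + i + 1 : ℕ) : ℤ)) (th (k + i) - θ) ^ 2 +
        12 * radius Θ ^ 2 * ∑ j ∈ Finset.range p,
          (yh ((k + i - j : ℕ) : ℤ) - y ((k + i - j : ℕ) : ℤ)) ^ 2 +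
        3 * (M₁ * N * γ * M₂) ^ 2 / k) := by
  have hk' : (1 : ℝ) ≤ k := by exact_mod_cast hk
  have hM0' : 0 ≤ M₁ := (norm_nonneg _).trans (hM₁ 1 le_rfl)
  have hM0 : 0 ≤ M₂ := (norm_nonneg _).trans (hM₂ 1 le_rfl)
  refine (hexc ((k : ℤ) + 1) (by omega) (th k - θ)).trans ?_
  refine mul_le_mul_of_nonneg_left (Finset.sum_le_sum fun i hi => ?_) (by positivity)
  have hiN : (i : ℝ) ≤ N := by exact_mod_cast (Finset.mem_range.1 hi).le
  have e0 : (k : ℤ) + 1 + (i : ℤ) = ((k + i + 1 : ℕ) : ℤ) := by push_cast; ring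
  rw [e0]
  have hdiff := sq_inner_regressor_sub_le yh y u ((k + i + 1 : ℕ) : ℤ) (th (k + i) - θ)
  have e1 : ∑ j ∈ Finset.range p, (yh (((k + i + 1 : ℕ) : ℤ) - 1 - (j : ℕ)) -
      y (((k + i + 1 : ℕ) : ℤ) - 1 - (j : ℕ))) ^ 2 =
      ∑ j ∈ Finset.range p,
          (yh ((k + i - j : ℕ) : ℤ) - y ((k + i - j : ℕ) : ℤ)) ^ 2 := by
    refine Finset.sum_congr rfl fun j hj => ?_
    have hjp := Finset.mem_range.1 hj
    have e : ((k + i + 1 : ℕ) : ℤ) - 1 - (j : ℕ) = ((k + i - j : ℕ) : ℤ) := by omega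
    rw [e]
  rw [e1] at hdiff
  set T := ∑ j ∈ Finset.range p, (yh ((k + i - j : ℕ) : ℤ) - y ((k + i - j : ℕ) : ℤ)) ^ 2
  have hT0 : 0 ≤ T := Finset.sum_nonneg fun _ _ => sq_nonneg _
  set ψ := regressor p q yh u ((k + i + 1 : ℕ) : ℤ)
  set φ := regressor p q y u ((k + i + 1 : ℕ) : ℤ) with hφ
  have hφn : ‖φ‖ ≤ M₁ := hM₁ _ (by omega)
  have h2 : (inner ℝ ψ (th (k + i) - θ) - inner ℝ φ (th (k + i) - θ)) ^ 2 ≤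
      4 * radius Θ ^ 2 * T := by
    refine hdiff.trans (mul_le_mul_of_nonneg_right ((sum_sq_inl_le _).trans ?_) hT0)
    have h3 := norm_le_radius hΘc (hT.mem (k := k + i) (by omega))
    have h4 := norm_le_radius hΘc hθ
    have h5 : ‖th (k + i) - θ‖ ≤ 2 * radius Θ := (norm_sub_le _ _).trans (by linarith)
    calc _ ≤ (2 * radius Θ) ^ 2 := pow_le_pow_left₀ (norm_nonneg _) h5 2
      _ = _ := by ring
  have h3 : (inner ℝ φ (th (k + i) - th k)) ^ 2 ≤ (M₁ * N * γ * M₂) ^ 2 / k := by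
    have h4 : |inner ℝ φ (th (k + i) - th k)| ≤ M₁ * N * γ * M₂ / k := by
      calc _ ≤ ‖φ‖ * ‖th (k + i) - th k‖ := abs_real_inner_le_norm _ _
        _ ≤ M₁ * (N * (γ * M₂ / k)) := by
          refine mul_le_mul hφn ((hT.norm_sub_add_le hΘ hM₂ hγ hs hF hk i).trans ?_)
            (norm_nonneg _) hM0'
          exact mul_le_mul_of_nonneg_right hiN (by positivity)
        _ = _ := by ring
    rw [← sq_abs]
    refine (pow_le_pow_left₀ (abs_nonneg _) h4 2).trans ?_
    rw [div_pow]
    -- As k ≥ 1, the bound by 1/k² is weakened to 1/k, which suffices later.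
    exact div_le_div_of_nonneg_left (sq_nonneg _) (by linarith) (by nlinarith)
  have e4 : inner ℝ φ (th k - θ) = inner ℝ ψ (th (k + i) - θ) -
      (inner ℝ ψ (th (k + i) - θ) - inner ℝ φ (th (k + i) - θ)) -
      inner ℝ φ (th (k + i) - th k) := by
    rw [inner_sub_right φ (th k), inner_sub_right φ (th (k + i)) (th k),
      inner_sub_right φ (th (k + i)) θ]
    ring
  rw [e4]
  have h6 : ∀ a b c : ℝ, (a - b - c) ^ 2 ≤ 3 * a ^ 2 + 3 * b ^ 2 + 3 * c ^ 2 := by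
    intro a b c
    nlinarith [sq_nonneg (a + b), sq_nonneg (a + c), sq_nonneg (b - c)]
  refine (h6 _ _ _).trans ?_
  rw [mul_div_assoc]
  linarith

end Pathwise

/-! ### Taking expectations and passing to the limit. -/

section Convergence

variable {Ω : Type*} [MeasurableSpace Ω] {μ : Measure Ω} [IsProbabilityMeasure μ]

lemma integral_le_of_ae_step {V V' Z H G G' W : Ω → ℝ} {a b c e w : ℝ} (iV : Integrable V μ)
    (iV' : Integrable V' μ) (iZ : Integrable Z μ) (iH : Integrable H μ) (iG : Integrable G μ)
    (iG' : Integrable G' μ) (iW : Integrable W μ) (hW : ∫ ω, W ω ∂μ = 0)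
    (h : ∀ᵐ ω ∂μ, V' ω ≤
      V ω + a * (-b * (Z ω + H ω) - c * (G' ω - G ω)) + e + w * W ω) :
    ∫ ω, V' ω ∂μ ≤ ∫ ω, V ω ∂μ + a * (-b * (∫ ω, Z ω ∂μ + ∫ ω, H ω ∂μ) -
      (c * ∫ ω, G' ω ∂μ - c * ∫ ω, G ω ∂μ)) + e := by
  have iS : Integrable (fun ω => Z ω + H ω) μ := iZ.add iH
  have iD : Integrable (fun ω => G' ω - G ω) μ := iG'.sub iG
  have iT : Integrable (fun ω => -b * (Z ω + H ω) - c * (G' ω - G ω)) μ :=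
    (iS.const_mul _).sub (iD.const_mul _)
  have i1 : Integrable (fun ω => V ω + a * (-b * (Z ω + H ω) - c * (G' ω - G ω))) μ :=
    iV.add (iT.const_mul _)
  have i2 : Integrable (fun ω => V ω + a * (-b * (Z ω + H ω) - c * (G' ω - G ω)) + e) μ :=
    i1.add (integrable_const e)
  have i3 : Integrable (fun ω =>
      V ω + a * (-b * (Z ω + H ω) - c * (G' ω - G ω)) + e + w * W ω) μ := i2.add (iW.const_mul _)
  refine (integral_mono_ae iV' i3 h).trans (le_of_eq ?_)
  rw [integral_add i2 (iW.const_mul _), integral_add i1 (integrable_const e),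
    integral_add iV (iT.const_mul _), integral_const_mul,
    integral_sub (iS.const_mul _) (iD.const_mul _), integral_const_mul, integral_const_mul,
    integral_add iZ iH, integral_sub iG' iG, integral_const_mul, hW, integral_const,
    probReal_univ]
  simp only [one_smul]
  ring

lemma integral_le_of_ae_window {V : Ω → ℝ} {Z : ℕ → Ω → ℝ} {H : ℕ → ℕ → Ω → ℝ} {N p : ℕ}
    {δ a b r e : ℝ} (iV : Integrable V μ) (iZ : ∀ i, Integrable (Z i) μ)
    (iH : ∀ i, ∀ j < p, Integrable (H i j) μ)
    (h : ∀ᵐ ω ∂μ, δ * V ω ≤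
      r * ∑ i ∈ Finset.range N, (a * Z i ω + b * ∑ j ∈ Finset.range p, H i j ω + e)) :
    δ * ∫ ω, V ω ∂μ ≤ r * ∑ i ∈ Finset.range N,
      (a * ∫ ω, Z i ω ∂μ + b * ∑ j ∈ Finset.range p, ∫ ω, H i j ω ∂μ + e) := by
  have iS : ∀ i, Integrable (fun ω => ∑ j ∈ Finset.range p, H i j ω) μ := fun i =>
    integrable_finsetSum _ fun j hj => iH i j (Finset.mem_range.1 hj)
  have i1 : ∀ i, Integrable (fun ω => a * Z i ω + b * ∑ j ∈ Finset.range p, H i j ω) μ := fun i =>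
    ((iZ i).const_mul _).add ((iS i).const_mul _)
  have i2 : ∀ i, Integrable (fun ω => a * Z i ω + b * ∑ j ∈ Finset.range p, H i j ω + e) μ :=
    fun i => (i1 i).add (integrable_const e)
  rw [← integral_const_mul]
  refine (integral_mono_ae (iV.const_mul _)
    ((integrable_finsetSum _ fun i _ => i2 i).const_mul _) h).trans (le_of_eq ?_)
  rw [integral_const_mul, integral_finsetSum _ fun i _ => i2 i]
  congr 1
  refine Finset.sum_congr rfl fun i _ => ?_
  rw [integral_add (i1 i) (integrable_const e), integral_add ((iZ i).const_mul _)
    ((iS i).const_mul _), integral_const_mul, integral_const_mul,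
    integral_finsetSum _ fun j hj => iH i j (Finset.mem_range.1 hj), integral_const,
    probReal_univ, one_smul]

lemma le_sum_of_mul_le_sum {Z : ℕ → ℝ} {H : ℕ → ℕ → ℝ} {N p : ℕ} {V δ a b e κ : ℝ} (ha : 0 ≤ a)
    (hb : 0 ≤ b) (he : 0 ≤ e) (hδ : 0 < δ) (hN : 0 < N) (hκ : 0 < κ) (hZ : ∀ i, 0 ≤ Z i)
    (hH : ∀ i j, 0 ≤ H i j)
    (h : δ * V ≤ 1 / (N : ℝ) * ∑ i ∈ Finset.range N,
      (a * Z i + b * ∑ j ∈ Finset.range p, H i j + e / κ)) :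
    V ≤ ∑ i ∈ Finset.range N, ((a + b + N * e) / (N * δ) * Z i +
      ∑ j ∈ Finset.range p, (a + b + N * e) / (N * δ) * H i j) +
        (a + b + N * e) / (N * δ) / κ := by
  have hN' : (0 : ℝ) < N := by exact_mod_cast hN
  have hNe : 0 ≤ N * e := by positivity
  rw [one_div, ← div_eq_inv_mul, le_div_iff₀ hN', Finset.sum_add_distrib, Finset.sum_const,
    Finset.card_range, nsmul_eq_mul] at h
  have h1 : ∑ i ∈ Finset.range N, (a * Z i + b * ∑ j ∈ Finset.range p, H i j) ≤
      (a + b + N * e) * ∑ i ∈ Finset.range N, (Z i + ∑ j ∈ Finset.range p, H i j) := by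
    rw [Finset.mul_sum]
    refine Finset.sum_le_sum fun i _ => ?_
    rw [mul_add]
    exact add_le_add (mul_le_mul_of_nonneg_right (by linarith) (hZ i))
      (mul_le_mul_of_nonneg_right (by linarith) (Finset.sum_nonneg fun j _ => hH i j))
  have h2 : N * (e / κ) ≤ (a + b + N * e) / κ := by
    rw [mul_div_assoc']
    exact div_le_div_of_nonneg_right (by linarith) hκ.le
  have e1 : ∑ i ∈ Finset.range N, ((a + b + N * e) / (N * δ) * Z i +
      ∑ j ∈ Finset.range p, (a + b + N * e) / (N * δ) * H i j) +
        (a + b + N * e) / (N * δ) / κ = ((a + b + N * e) *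
        ∑ i ∈ Finset.range N, (Z i + ∑ j ∈ Finset.range p, H i j) + (a + b + N * e) / κ) /
          (N * δ) := by
    simp only [← Finset.mul_sum, ← mul_add]
    rw [add_div]
    ring
  rw [e1, le_div_iff₀ (by positivity)]
  linarith

variable {p q : ℕ} {Θ : Set (Param p q)} {θ : Param p q} {C γ : ℝ} {F f : ℝ → ℝ}
  {u y : ℤ → ℝ} {d : ℕ → Ω → ℝ} {θhat : ℕ → Ω → Param p q} {yhat : ℤ → Ω → ℝ}

/-- Mean-square convergence under the small gain condition `fM s / (1 - s) < fm`, where `s` is the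
gain of the autoregressive part. -/
lemma tendsto_integral_norm_sub_sq (hp : 0 < p)
    (hΘ : Convex ℝ Θ) (hΘc : IsCompact Θ) (hθ : θ ∈ Θ) (hd : IsNoise μ d F f)
    (hy : IsOutput θ u y) (hγ : 0 < γ)
    (hθp : ∀ n, PastDetermined C y d n (θhat n))
    (hyp : ∀ (n : ℕ) (k : ℤ), k ≤ n → PastDetermined C y d n (yhat k))
    (halg : ∀ ω, IsTrajectory Θ γ C F u (fun k => binaryObs C (y k + d k ω))
      (fun k => θhat k ω) (fun k => yhat k ω))
    {M₁ M₂ δ fm fM : ℝ} {N : ℕ}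
    (hM₁ : ∀ k : ℤ, 1 ≤ k → ‖regressor p q y u k‖ ≤ M₁)
    (hM₂ : ∀ᵐ ω ∂μ, ∀ k : ℤ, 1 ≤ k → ‖regressor p q (fun i => yhat i ω) u k‖ ≤ M₂)
    (hN : 0 < N) (hδ : 0 < δ) (hexc : Excites (regressor p q y u) N δ)
    (hfM : IsGreatest (f '' densityRange C (radius Θ) M₁ M₂) fM)
    (hfm : IsLeast (f '' densityRange C (radius Θ) M₁ M₂) fm) (hfM0 : 0 ≤ fM)
    (hs : 0 < arGain θ) (hs1 : arGain θ < 1)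
    (hgain : fM * (arGain θ / (1 - arGain θ)) < fm) :
    Tendsto (fun k : ℕ => ∫ ω, ‖θhat k ω - θ‖ ^ 2 ∂μ) atTop (𝓝 0) := by
  obtain ⟨c₁, c₂, c₃, hc₁, hc₂, hc₃, hsg⟩ := exists_small_gain hs hs1 hfM0 hgain
  have hM₁0 : 0 ≤ M₁ := (norm_nonneg _).trans (hM₁ 1 le_rfl)
  have hM₂0 : 0 ≤ M₂ := by
    obtain ⟨ω, hω⟩ := hM₂.exists
    exact (norm_nonneg _).trans (hω 1 le_rfl)
  have hbit : ∀ ω (k : ℕ), 0 ≤ binaryObs C (y k + d k ω) ∧ binaryObs C (y k + d k ω) ≤ 1 := by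
    intro ω k
    unfold binaryObs
    split_ifs <;> norm_num
  have hbitp : ∀ n : ℕ, PastDetermined C y d (n + 1)
      fun ω => binaryObs C (y ((n + 1 : ℕ) : ℤ) + d (n + 1) ω) :=
    fun n ω ω' h => h (n + 1) (by omega) le_rfl
  have hregp : ∀ n : ℕ, PastDetermined C y d n
      fun ω => regressor p q (fun i => yhat i ω) u ((n + 1 : ℕ) : ℤ) :=
    fun n ω ω' h => regressor_congr fun i hi => hyp n i (by push_cast at hi; omega) ω ω' h
  have hzp : ∀ n : ℕ, PastDetermined C y d n fun ω =>
      (inner ℝ (regressor p q (fun i => yhat i ω) u ((n + 1 : ℕ) : ℤ)) (θhat n ω - θ) : ℝ) :=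
    fun n => (hregp n).comp₂ (hθp n) fun a b => inner ℝ a (b - θ)
  have hstp : ∀ n : ℕ, PastDetermined C y d n fun ω =>
      storage θ (fun i => yhat i ω - y i) n := by
    intro n ω ω' h
    refine congrArg (fun t : ℝ => (∑ j : Fin p, θ (Sum.inl j) ^ 2) * t)
      (Finset.sum_congr rfl fun j _ => ?_)
    beta_reduce
    rw [hyp n ((n : ℤ) - (j : ℕ)) (by omega) ω ω' h]
  have iV : ∀ n, Integrable (fun ω => ‖θhat n ω - θ‖ ^ 2) μ := fun n =>
    PastDetermined.integrable hd ((hθp n).comp fun a => ‖a - θ‖ ^ 2)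
  have iZ : ∀ n : ℕ, Integrable (fun ω => (inner ℝ
      (regressor p q (fun i => yhat i ω) u ((n + 1 : ℕ) : ℤ)) (θhat n ω - θ) : ℝ) ^ 2) μ := fun n =>
    PastDetermined.integrable hd ((hzp n).comp fun a => a ^ 2)
  have iH : ∀ n : ℕ, Integrable (fun ω => (yhat (n : ℤ) ω - y n) ^ 2) μ := fun n =>
    PastDetermined.integrable hd ((hyp n n le_rfl).comp fun a => (a - y n) ^ 2)
  have iG : ∀ n : ℕ, Integrable (fun ω => storage θ (fun i => yhat i ω - y i) n) μ := fun n =>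
    PastDetermined.integrable hd (hstp n)
  have hηb : ∀ᵐ ω ∂μ, ∀ k : ℤ, 0 ≤ k → |yhat k ω - y k| ≤ M₁ + M₂ := by
    filter_upwards [hM₂] with ω hω k hk
    have h2 := abs_le_of_norm_regressor_le hp hω hk
    have h3 := abs_le_of_norm_regressor_le hp hM₁ hk
    have := abs_sub (yhat k ω) (y k)
    linarith
  set B : ℝ := (∑ j : Fin p, θ (Sum.inl j) ^ 2) * (p * (p * (M₁ + M₂) ^ 2)) with hB
  set c : ℝ := (3 + 12 * radius Θ ^ 2 + 3 * N * (M₁ * N * γ * M₂) ^ 2) / (N * δ) with hc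
  have hN' : (0 : ℝ) < N := by exact_mod_cast hN
  -- The start `k₀ = p` keeps all indices in the storage function and the windows nonnegative, where
  -- η is bounded. `Z n` pairs the regressor at time n with the estimate at n - 1.
  refine tendsto_zero_of_lyapunov (k₀ := p) (N := N) (p := p)
    (Z := fun n => ∫ ω, (inner ℝ (regressor p q (fun i => yhat i ω) u (n : ℤ))
      (θhat (n - 1) ω - θ) : ℝ) ^ 2 ∂μ)
    (H := fun n => ∫ ω, (yhat (n : ℤ) ω - y n) ^ 2 ∂μ)
    (G := fun n => 2 * γ * c₂ * ∫ ω, storage θ (fun i => yhat i ω - y i) n ∂μ)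
    (a := 2 * γ * c₁) (b := 4 * γ ^ 2 * c₃ * (M₁ + M₂) * M₂ ^ 2 + γ ^ 2 * M₂ ^ 2)
    (B := 2 * γ * c₂ * B) (c := c)
    (fun n => integral_nonneg fun ω => sq_nonneg _) (fun n => integral_nonneg fun ω => sq_nonneg _)
    (fun n => integral_nonneg fun ω => sq_nonneg _) ?_ (by positivity) (by positivity) hp ?_ ?_
  · intro k hk
    rw [abs_mul, abs_of_nonneg (by positivity : 0 ≤ 2 * γ * c₂)]
    refine mul_le_mul_of_nonneg_left ?_ (by positivity)
    have h1 : ∀ᵐ ω ∂μ, ‖storage θ (fun i => yhat i ω - y i) k‖ ≤ B := by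
      filter_upwards [hηb] with ω hω
      exact abs_storage_le θ hω hk
    simpa using norm_integral_le_of_norm_le_const h1
  · intro k hk
    have hmart : ∫ ω, (inner ℝ (regressor p q (fun i => yhat i ω) u ((k + 1 : ℕ) : ℤ))
        (θhat k ω - θ) : ℝ) * (F (C - y ((k + 1 : ℕ) : ℤ)) -
          binaryObs C (y ((k + 1 : ℕ) : ℤ) + d (k + 1) ω)) ∂μ = 0 := by
      simp only [mul_sub]
      rw [integral_sub, integral_mul_const, (hzp k).integral_mul_binaryObs hd, sub_self]
      · exact (PastDetermined.integrable hd (hzp k)).mul_const _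
      · exact PastDetermined.integrable hd
          (((hzp k).mono (Nat.le_succ k)).comp₂ (hbitp k) fun a b => a * b)
    have iM : Integrable (fun ω =>
        (inner ℝ (regressor p q (fun i => yhat i ω) u ((k + 1 : ℕ) : ℤ))
        (θhat k ω - θ) : ℝ) * (F (C - y ((k + 1 : ℕ) : ℤ)) -
          binaryObs C (y ((k + 1 : ℕ) : ℤ) + d (k + 1) ω))) μ :=
      PastDetermined.integrable hd (((hzp k).mono (Nat.le_succ k)).comp₂ (hbitp k)
        fun a b => a * (F (C - y ((k + 1 : ℕ) : ℤ)) - b))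
    refine integral_le_of_ae_step (w := 2 * γ / ((k : ℝ) + 1)) (iV k) (iV (k + 1)) (iZ k)
      (iH (k + 1)) (iG k) (iG (k + 1)) iM hmart ?_
    filter_upwards [hM₂] with ω hω
    exact (halg ω).lyapunov_step hp hΘ hΘc hθ hω hM₁ hy hγ (hbit ω) hd.mem_Icc hd.hasDerivAt
      hd.density_nonneg hfM hfm hsg (by omega)
  · intro k hk
    have hk' : (0 : ℝ) < k := by exact_mod_cast hp.trans_le hk
    have h1 := integral_le_of_ae_window (μ := μ) (δ := δ) (N := N) (p := p)
      (V := fun ω => ‖θhat k ω - θ‖ ^ 2)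
      (Z := fun i ω => (inner ℝ (regressor p q (fun i => yhat i ω) u ((k + i + 1 : ℕ) : ℤ))
        (θhat (k + i) ω - θ) : ℝ) ^ 2)
      (H := fun i j ω => (yhat ((k + i - j : ℕ) : ℤ) ω - y ((k + i - j : ℕ) : ℤ)) ^ 2)
      (a := 3) (b := 12 * radius Θ ^ 2) (r := 1 / (N : ℝ))
      (e := 3 * (M₁ * N * γ * M₂) ^ 2 / k) (iV k) (fun i => iZ (k + i))
      (fun i j _ => iH (k + i - j)) (by
        filter_upwards [hM₂] with ω hω
        exact (halg ω).window_bound hΘ hΘc hθ hω hM₁ hγ (hbit ω) hd.mem_Icc hexc (by omega) hk)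
    have h2 := le_sum_of_mul_le_sum (V := ∫ ω, ‖θhat k ω - θ‖ ^ 2 ∂μ) (by norm_num)
      (by positivity) (by positivity) hδ hN hk' (fun i => integral_nonneg fun ω => sq_nonneg _)
      (fun i j => integral_nonneg fun ω => sq_nonneg _) h1
    refine h2.trans (le_of_eq ?_)
    simp only [add_right_comm k 1, Nat.add_sub_cancel]
    rw [hc, show 3 * (N : ℝ) * (M₁ * N * γ * M₂) ^ 2 = N * (3 * (M₁ * N * γ * M₂) ^ 2) by ring]

end Convergence

end BinaryARMA

theorem theorem1
    {Ω : Type*} [MeasurableSpace Ω] (μ : Measure Ω) [IsProbabilityMeasure μ]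
    (p q : ℕ) (hp : 0 < p) (_hq : 0 < q)
    -- the parameter set and the true parameter
    (h : ℝ) (hh_pos : 0 < h) (hh_lt : h < 1)
    (Θ : Set (Param p q)) (hΘ_convex : Convex ℝ Θ) (hΘ_compact : IsCompact Θ)
    (hΘ_causal : Θ ⊆ causalSet p q h)
    (θ : Param p q) (hθ : θ ∈ Θ)
    (hθ_order : θ (Sum.inl ⟨p - 1, Nat.sub_one_lt_of_lt hp⟩) ≠ 0)
    (hθ_coprime : ∀ z : ℂ, ¬ ((arPoly θ).eval z = 0 ∧ (maPoly θ).eval z = 0))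
    -- the noise
    (d : ℕ → Ω → ℝ) (F f : ℝ → ℝ) (hd : IsNoise μ d F f)
    -- the input and the output
    (u : ℤ → ℝ) (hu_bdd : ∃ K : ℝ, ∀ k : ℤ, 1 ≤ k → |u k| ≤ K)
    (m : ℕ) (hm : 0 < m) (δ₁ : ℝ) (hδ₁ : 0 < δ₁)
    (hu_exc : Excites (inputWindow (p + q) u) m δ₁)
    (y : ℤ → ℝ) (hy : IsOutput θ u y)
    -- the algorithm, run on the binary observations, from deterministic initial values
    (C γ : ℝ) (hγ : 0 < γ)
    (θhat : ℕ → Ω → Param p q) (yhat : ℤ → Ω → ℝ)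
    (θ₀ : Param p q) (hθ₀ : ∀ ω, θhat 0 ω = θ₀)
    (y₀ : ℤ → ℝ) (hy₀ : ∀ k : ℤ, k ≤ 0 → ∀ ω, yhat k ω = y₀ k)
    (halg : ∀ ω, IsTrajectory Θ γ C F u (fun k => binaryObs C (y k + d k ω))
      (fun k => θhat k ω) (fun k => yhat k ω)) :
    -- the constants that belong to the system exist
    (∃ ε : ℝ, 0 < ε ∧ specRad (companion θ) + ε * opNorm (companion θ) < 1) ∧
    (∃ M₁ : ℝ, 0 < M₁ ∧ ∀ k : ℤ, 1 ≤ k → ‖regressor p q y u k‖ ≤ M₁) ∧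
    (∃ δ : ℝ, 0 < δ ∧ Excites (regressor p q y u) (p + m) δ) ∧
    -- and the estimates converge, whatever the admissible constants in the condition are
    ∀ ε h₁ M₁ M₂ δ fM fm : ℝ,
      0 < ε → specRad (companion θ) + ε * opNorm (companion θ) ≤ h₁ → h₁ < 1 →
      0 < M₁ → (∀ k : ℤ, 1 ≤ k → ‖regressor p q y u k‖ ≤ M₁) →
      0 < M₂ →
      (∀ k : ℤ, 1 ≤ k → ∀ᵐ ω ∂μ, ‖regressor p q (fun i => yhat i ω) u k‖ ≤ M₂) →
      0 < δ → Excites (regressor p q y u) (p + m) δ →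
      IsGreatest (f '' densityRange C (radius Θ) M₁ M₂) fM →
      IsLeast (f '' densityRange C (radius Θ) M₁ M₂) fm →
      0 < fm * δ -
        fM * Real.sqrt (gBound p h) * M₂ * powerConst p ε / (1 - h₁) * (M₂ + 2 * M₁) →
      (∀ k : ℕ, Integrable (fun ω => ‖θhat k ω - θ‖ ^ 2) μ) ∧
        Tendsto (fun k : ℕ => ∫ ω, ‖θhat k ω - θ‖ ^ 2 ∂μ) atTop (𝓝 0) := by
  have hθc := hΘ_causal hθ
  refine ⟨exists_pos_specRad_add_lt hh_pos hh_lt hθc,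
    exists_norm_regressor_le hh_pos hh_lt hθc hu_bdd hy,
    exists_excites_regressor hp hθ_order hθ_coprime hy hm hδ₁ hu_exc, ?_⟩
  intro ε h₁ M₁ M₂ δ fM fm hε hh₁ hh₁1 hM₁0 hM₁ hM₂0 hM₂ hδ hexc hfM hfm hcond
  have hpast := pastDetermined_trajectory hΘ_convex hθ₀ hy₀ halg
  -- There are countably many times, so one null set serves them all and the pathwise estimates
  -- apply off it.
  have hM₂' : ∀ᵐ ω ∂μ, ∀ k : ℤ, 1 ≤ k → ‖regressor p q (fun i => yhat i ω) u k‖ ≤ M₂ := by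
    rw [ae_all_iff]
    intro k
    by_cases hk : 1 ≤ k
    · filter_upwards [hM₂ k hk] with ω hω _ using hω
    · exact ae_of_all _ fun ω h => absurd h hk
  have hδM : δ ≤ M₂ ^ 2 := by
    obtain ⟨ω, hω⟩ := hM₂'.exists
    exact le_sq_of_excites _hq (by omega) hexc hω
  have hfM0 : 0 ≤ fM := by
    obtain ⟨x, _, rfl⟩ := hfM.1
    exact hd.density_nonneg x
  obtain ⟨hs1, hgain⟩ := arGain_small hp hh_pos hθc hε hh₁ hh₁1 hM₁0 hM₂0 hδ hδM hfM0
    (hfM.2 hfm.1) hcond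
  exact ⟨fun k => PastDetermined.integrable hd ((hpast k).1.comp fun a => ‖a - θ‖ ^ 2),
    tendsto_integral_norm_sub_sq hp hΘ_convex hΘ_compact hθ hd hy hγ (fun n => (hpast n).1)
      (fun n => (hpast n).2) halg hM₁ hM₂' (by omega) hδ hexc hfM hfm hfM0
      (arGain_pos hθ_order) hs1 hgain⟩
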